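/- For a finite graph $G$ on $n\ge 1$ vertices, order the vertices uniformly at random and build an independent set $\mathbf I(G)$ by going through the vertices in this order and adding a vertex whenever the resulting set spans no edge; let $\iota(G)=|\mathbf I(G)|/n$ (if $G$ is random, the order is independent of $G$). For a random rooted, possibly infinite, graph $(U,\rho)$ give the vertices independent labels, uniform in $[0,1]$ and independent of $U$, and let the past of $\rho$ be the set of vertices reachable from $\rho$ by paths along which the labels decrease. If the past of $\rho$ is almost surely finite, $(U,\rho)$ is said to have nonexplosive growth, and $\iota(U,\rho)$ denotes the probability that $\rho$ belongs to the greedy independent set of the subgraph induced by the past of $\rho$, its vertices being considered in increasing order of their labels. For $0<\lambda\le 1$ let $GW(\lambda)$ be the Galton--Watson tree with offspring distribution $\mathrm{Pois}(\lambda)$, and let $\widehat{GW}(\lambda)$ be the size-biased Poisson Galton--Watson tree, i.e. the two-type branching process in which the root is a spine vertex, a spine vertex has exactly one spine child and, independently, $\mathrm{Pois}(\lambda)$ tree children, and a tree vertex has $\mathrm{Pois}(\lambda)$ tree children, all offspring numbers being independent. Then both trees have nonexplosive growth, and $$\iota(\widehat{GW}(\lambda))=1-(1+\lambda)^{-1/\lambda}=1-e^{-\iota(GW(\lambda))};$$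 in particular $\iota(\widehat{GW}(1))=1/2$. Moreover, if $T_n$ is uniformly distributed among the $n^{n-2}$ labelled trees on $n$ vertices, then $\iota(T_n)\sim 1/2$ with high probability, that is, for every $\varepsilon>0$, $$\Pr\left[\,|2\,\iota(T_n)-1|\le\varepsilon\,\right]\to 1\qquad(n\to\infty).$$ The same holds for the random functional digraph on $n$ vertices with orientations ignored, that is, for the simple graph on $\{1,\dots,n\}$ whose edges are the pairs $\{i,f(i)\}$ with $f(i)\ne i$, where $f$ is a uniformly random map from $\{1,\dots,n\}$ to itself. -/

import Mathlib

open MeasureTheory ProbabilityTheory Filter Topology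
open scoped NNReal ENNReal

namespace GreedyMIS

/-- The greedy algorithm: the vertices of `l` are considered one by one in order, and a vertex is
added if the resulting set still spans no edge. -/
def greedySet {V : Type*} (G : SimpleGraph V) (l : List V) : Set V :=
  l.foldl (fun I v => I ∪ {w | w = v ∧ ∀ u ∈ I, ¬ G.Adj u v}) ∅

/-! ### Finite random graphs -/

/-- The density of the greedy independent set of a graph on `n` labelled vertices, when the vertices
are considered in the order `π 0, π 1, …, π (n - 1)`. -/
noncomputable def greedyRatio {n : ℕ} (G : SimpleGraph (Fin n)) (π : Equiv.Perm (Fin n)) : ℝ :=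
  ((greedySet G (List.ofFn π)).ncard : ℝ) / (n : ℝ)

/-- The law of the greedy independence ratio `ι(G)` of a random graph `G` with law `p`:
`G` is sampled from `p` and then, independently, a uniform random order of the vertices is
sampled. -/
noncomputable def greedyRatioLaw {n : ℕ} (p : PMF (SimpleGraph (Fin n))) : PMF ℝ :=
  p.bind fun G => (PMF.uniformOfFintype (Equiv.Perm (Fin n))).map (greedyRatio G)

/-- `X n ∼ c` with high probability, for random variables `X n` with laws `L n` and a nonzero
constant `c`: for every `ε > 0`, the probability that `|X n / c - 1| ≤ ε` tends to `1`. -/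
def AsympWhp (L : ℕ → PMF ℝ) (c : ℝ) : Prop :=
  ∀ ε : ℝ, 0 < ε → Tendsto (fun n => (L n).toMeasure {x : ℝ | |x / c - 1| ≤ ε}) atTop (𝓝 1)

theorem exists_labelled_tree (n : ℕ) [NeZero n] :
    (Set.toFinite {G : SimpleGraph (Fin n) | G.IsTree}).toFinset.Nonempty := by
  obtain ⟨T, -, hT⟩ := (SimpleGraph.connected_top (V := Fin n)).exists_isTree_le
  exact ⟨T, by simpa using hT⟩

/-- The uniform random labelled tree on `n ≥ 1` vertices. -/
noncomputable def uniformTree (n : ℕ) [NeZero n] : PMF (SimpleGraph (Fin n)) :=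
  PMF.uniformOfFinset (Set.toFinite {G : SimpleGraph (Fin n) | G.IsTree}).toFinset
    (exists_labelled_tree n)

/-- The graph underlying the functional digraph with edges `(i, f i)`: orientations (and loops and
multiplicities) are ignored. -/
def functionalGraph {n : ℕ} (f : Fin n → Fin n) : SimpleGraph (Fin n) :=
  SimpleGraph.fromRel fun i j => f i = j

/-- The random functional digraph on `n ≥ 1` vertices, with orientations ignored: the map `f` is
uniform among all maps from the vertex set to itself. -/
noncomputable def randomFunctionalGraph (n : ℕ) [NeZero n] : PMF (SimpleGraph (Fin n)) :=
  (PMF.uniformOfFintype (Fin n → Fin n)).map functionalGraph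

/-! ### Random rooted infinite graphs -/

/-- The past of `v`: all vertices reachable from `v` by a path along which the labels decrease. -/
def past {V : Type*} (G : SimpleGraph V) (σ : V → unitInterval) (v : V) : Set V :=
  {w | Relation.ReflTransGen (fun a b => G.Adj a b ∧ σ b < σ a) v w}

/-- `l` lists the elements of the (finite) set `S` in increasing order of their labels. -/
def IsArrivalOrder {V : Type*} (σ : V → unitInterval) (S : Set V) (l : List V) : Prop :=
  l.Pairwise (fun u v => σ u < σ v) ∧ ∀ v, v ∈ l ↔ v ∈ S

/-- The past of `ρ` is finite, and `ρ` belongs to the greedy independent set of the subgraph induced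
by the past of `ρ`, when the vertices are considered in increasing order of their labels. -/
def RootOccupied {V : Type*} (G : SimpleGraph V) (σ : V → unitInterval) (ρ : V) : Prop :=
  ∃ l : List V, IsArrivalOrder σ (past G σ ρ) l ∧ ρ ∈ greedySet G l

/-- The law of a random labelling: i.i.d. labels, uniform in `[0, 1]`. -/
noncomputable def labelLaw (V : Type*) : Measure (V → unitInterval) :=
  Measure.infinitePi fun _ => volume

/-- The random graph `U` (defined on the probability space `(Ω, P)`, with root `ρ`; only the
component of `ρ` matters) has nonexplosive growth: under an independent random labelling, the past
of the root is almost surely finite. -/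
def NonexplosiveGrowth {Ω V : Type*} [MeasurableSpace Ω] (P : Measure Ω) (U : Ω → SimpleGraph V)
    (ρ : V) : Prop :=
  ∀ᵐ p ∂(P.prod (labelLaw V)), (past (U p.1) p.2 ρ).Finite

/-- `ι(U, ρ)`: the probability that the root belongs to the greedy independent set of its past. -/
noncomputable def iota {Ω V : Type*} [MeasurableSpace Ω] (P : Measure Ω) (U : Ω → SimpleGraph V)
    (ρ : V) : ℝ :=
  (P.prod (labelLaw V)).real {p | RootOccupied (U p.1) p.2 ρ}

/-! ### Multitype branching processes -/

/-- Potential vertices: the root is the empty list, and `(j, i) :: v` is the `i`-th child of type `j`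
of `v`, with `i` counted from `0`. -/
abbrev Node (T : Type*) := List (T × ℕ)

/-- The type of a vertex, when the root has type `τ`. -/
def nodeType {T : Type*} (τ : T) : Node T → T
  | [] => τ
  | c :: _ => c.1

/-- The vertices that are present in the tree, when `v` has `ξ v j` children of type `j`. -/
def InTree {T : Type*} (ξ : Node T → T → ℕ) : Node T → Prop
  | [] => True
  | c :: v => InTree ξ v ∧ c.2 < ξ v c.1

/-- The family tree with offspring numbers `ξ`, as a graph (with root `[]`) on all potential
vertices; those that are not present in the tree are isolated. -/
def branchingTree {T : Type*} (ξ : Node T → T → ℕ) : SimpleGraph (Node T) :=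
  SimpleGraph.fromRel fun u v => InTree ξ v ∧ ∃ c : T × ℕ, v = c :: u

/-- The law of the offspring numbers in the simple multitype branching process with root type `τ`
and offspring distributions `μ k j` (the law of the number of children of type `j` of a vertex of
type `k`): all the offspring numbers are independent. -/
noncomputable def offspringLaw {T : Type*} (τ : T) (μ : T → T → Measure ℕ) :
    Measure (Node T → T → ℕ) :=
  Measure.infinitePi fun v => Measure.infinitePi fun j => μ (nodeType τ v) j

/-- Nonexplosive growth of a simple multitype branching process. -/
def BPNonexplosive {T : Type*} (τ : T) (μ : T → T → Measure ℕ) : Prop :=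
  NonexplosiveGrowth (offspringLaw τ μ) branchingTree []

/-- The value of `ι` at a simple multitype branching process. -/
noncomputable def bpIota {T : Type*} (τ : T) (μ : T → T → Measure ℕ) : ℝ :=
  iota (offspringLaw τ μ) branchingTree []

/-- Offspring distribution of the Poisson Galton–Watson tree, which has a single type. -/
noncomputable def gwOffspring (lam : ℝ≥0) : Unit → Unit → Measure ℕ :=
  fun _ _ => poissonMeasure lam

/-- The types of the size-biased Poisson Galton–Watson tree. -/
inductive SBType
  | spine
  | tree

/-- Offspring distributions of the size-biased Poisson Galton–Watson tree: a spine vertex has one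
spine child and `Pois(lam)` tree children, and a tree vertex has `Pois(lam)` tree children. -/
noncomputable def sbgwOffspring (lam : ℝ≥0) : SBType → SBType → Measure ℕ
  | .spine, .spine => Measure.dirac 1
  | .tree, .spine => Measure.dirac 0
  | _, .tree => poissonMeasure lam

end GreedyMIS

namespace GreedyMIS

theorem greedySet_concat {V : Type*} (G : SimpleGraph V) (l : List V) (v : V) :
    greedySet G (l ++ [v]) =
      greedySet G l ∪ {w | w = v ∧ ∀ u ∈ greedySet G l, ¬ G.Adj u v} := by
  simp [greedySet, List.foldl_append]

theorem greedySet_map_equiv {V W : Type*} (G : SimpleGraph W) (e : V ≃ W) (l : List V) :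
    greedySet G (l.map e) = e '' greedySet (G.comap e) l := by
  induction l using List.reverseRecOn with
  | nil => simp [greedySet]
  | append_singleton l v ih =>
    rw [List.map_append, List.map_singleton, greedySet_concat, greedySet_concat, ih,
      Set.image_union]
    congr 1
    ext w
    constructor
    · rintro ⟨rfl, h⟩
      exact ⟨v, ⟨rfl, fun u hu => h _ ⟨u, hu, rfl⟩⟩, rfl⟩
    · rintro ⟨_, ⟨rfl, h⟩, rfl⟩
      refine ⟨rfl, ?_⟩
      rintro _ ⟨u, hu, rfl⟩
      exact h u hu

section FunctionalGraph

variable {n : ℕ}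

theorem functionalGraph_adj {f : Fin n → Fin n} {u v : Fin n} :
    (functionalGraph f).Adj u v ↔ u ≠ v ∧ (f u = v ∨ f v = u) := by
  simp [functionalGraph]

theorem functionalGraph_comap (f : Fin n → Fin n) (π : Equiv.Perm (Fin n)) :
    (functionalGraph f).comap π = functionalGraph (π.symm ∘ f ∘ π) := by
  ext u v
  simp [functionalGraph_adj, Equiv.symm_apply_eq]

/-- The greedy independent set of `functionalGraph f` after the vertices `0, …, k - 1` have been
considered in this order. -/
def selected (f : Fin n → Fin n) : ℕ → Finset (Fin n)
  | 0 => ∅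
  | k + 1 =>
    if h : k < n then
      if (⟨k, h⟩ : Fin n) ∈ (selected f k).image f ∨ f ⟨k, h⟩ ∈ selected f k then selected f k
      else insert ⟨k, h⟩ (selected f k)
    else selected f k

theorem lt_of_mem_selected {f : Fin n → Fin n} {k : ℕ} {u : Fin n} (hu : u ∈ selected f k) :
    (u : ℕ) < k := by
  induction k with
  | zero => simp [selected] at hu
  | succ k ih =>
    rw [selected] at hu
    split_ifs at hu with h h'
    · exact (ih hu).trans k.lt_succ_self
    · rcases Finset.mem_insert.1 hu with rfl | hu
      · exact k.lt_succ_self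
      · exact (ih hu).trans k.lt_succ_self
    · exact (ih hu).trans k.lt_succ_self

theorem selected_congr {f g : Fin n → Fin n} {k : ℕ} (h : ∀ u : Fin n, (u : ℕ) < k → f u = g u) :
    selected f k = selected g k := by
  induction k with
  | zero => rfl
  | succ k ih =>
    have hk := ih fun u hu => h u (hu.trans k.lt_succ_self)
    have himg : (selected g k).image f = (selected g k).image g :=
      Finset.image_congr fun u hu => h u ((lt_of_mem_selected hu).trans k.lt_succ_self)
    rw [selected, selected, hk, himg]
    split
    · rw [h _ k.lt_succ_self]
    · rfl

theorem greedySet_take_finRange (f : Fin n → Fin n) {k : ℕ} (hk : k ≤ n) :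
    greedySet (functionalGraph f) ((List.finRange n).take k) = selected f k := by
  induction k with
  | zero => simp [greedySet, selected]
  | succ k ih =>
    have hkn : k < n := hk
    rw [List.take_succ_eq_append_getElem (by simpa using hkn), greedySet_concat, ih hkn.le,
      selected, dif_pos hkn]
    simp only [List.getElem_finRange, Fin.cast_mk]
    have key : (∀ u ∈ (selected f k : Set (Fin n)), ¬ (functionalGraph f).Adj u ⟨k, hkn⟩) ↔
        ¬ ((⟨k, hkn⟩ : Fin n) ∈ (selected f k).image f ∨ f ⟨k, hkn⟩ ∈ selected f k) := by
      simp only [functionalGraph_adj, Finset.mem_image, not_or, not_exists, not_and,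
        Finset.mem_coe]
      constructor
      · intro h
        have hne : ∀ u ∈ selected f k, u ≠ ⟨k, hkn⟩ := by
          rintro u hu rfl
          exact lt_irrefl _ (lt_of_mem_selected hu)
        exact ⟨fun u hu => (h u hu (hne u hu)).1, fun hf => (h _ hf (hne _ hf)).2 rfl⟩
      · rintro ⟨h1, h2⟩ u hu -
        exact ⟨h1 u hu, fun h => h2 (h ▸ hu)⟩
    simp only [key]
    split_ifs with h
    · simp only [h, not_true, and_false]
      exact Set.union_empty _
    · simp only [h, not_false_eq_true, and_true, Finset.coe_insert]
      exact Set.union_singleton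

theorem greedyRatio_functionalGraph (f : Fin n → Fin n) (π : Equiv.Perm (Fin n)) :
    greedyRatio (functionalGraph f) π = ((selected (π.symm ∘ f ∘ π) n).card : ℝ) / n := by
  have h := greedySet_take_finRange (π.symm ∘ f ∘ π) le_rfl
  rw [List.take_of_length_le (by simp)] at h
  rw [greedyRatio, ← show (List.ofFn id).map π = List.ofFn π from List.map_ofFn ..,
    greedySet_map_equiv, functionalGraph_comap, Set.ncard_image_of_injective _ π.injective,
    List.ofFn_id, h, Set.ncard_coe_finset]

/-- The vertices `w ≥ k` that are not hit by the vertices selected among `0, …, k - 1`. -/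
def unhit (f : Fin n → Fin n) (k : ℕ) : Finset (Fin n) :=
  {w | k ≤ (w : ℕ) ∧ w ∉ (selected f k).image f}

/-- The deviation of the greedy process from its fluid limit. -/
noncomputable def deviation (f : Fin n → Fin n) (k : ℕ) : ℝ :=
  (unhit f k).card - n + 2 * (selected f k).card

theorem deviation_zero (f : Fin n → Fin n) : deviation f 0 = 0 := by
  simp [deviation, unhit, selected]

theorem deviation_last (f : Fin n → Fin n) : deviation f n = 2 * (selected f n).card - n := by
  have : unhit f n = ∅ := by
    ext w; simp [unhit]
  simp [deviation, this]; ring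

theorem deviation_congr {f g : Fin n → Fin n} {k : ℕ} (h : ∀ u : Fin n, (u : ℕ) < k → f u = g u) :
    deviation f k = deviation g k := by
  have hs := selected_congr h
  have himg : (selected g k).image f = (selected g k).image g :=
      Finset.image_congr fun u hu => h u (lt_of_mem_selected hu)
  simp only [deviation, unhit, hs, himg]

theorem deviation_succ_of_hit {f : Fin n → Fin n} {k : ℕ} (hk : k < n)
    (h : (⟨k, hk⟩ : Fin n) ∈ (selected f k).image f) :
    deviation f (k + 1) = deviation f k := by
  have hs : selected f (k + 1) = selected f k := by
    rw [selected, dif_pos hk, if_pos (Or.inl h)]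
  have hu : unhit f (k + 1) = unhit f k := by
    ext w
    simp only [unhit, hs, Finset.mem_filter, Finset.mem_univ, true_and]
    refine and_congr_left fun hw => ⟨fun h => by omega, fun hle => ?_⟩
    rcases hle.lt_or_eq with h' | h'
    · exact h'
    · exact absurd (by convert h; exact h'.symm) hw
  simp only [deviation, hs, hu]

/-- The increment of the deviation when the unhit vertex `k` is sent to `x`. -/
noncomputable def increment (f : Fin n → Fin n) (k : ℕ) (x : Fin n) : ℝ :=
  if x ∈ selected f k then -1 else if x ∈ unhit f k ∧ (x : ℕ) ≠ k then 0 else 1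

theorem deviation_succ_of_not_hit {f : Fin n → Fin n} {k : ℕ} (hk : k < n)
    (h : (⟨k, hk⟩ : Fin n) ∉ (selected f k).image f) :
    deviation f (k + 1) = deviation f k + increment f k (f ⟨k, hk⟩) := by
  have hmem : (⟨k, hk⟩ : Fin n) ∈ unhit f k := by simpa [unhit] using h
  have hcard := Finset.card_erase_add_one hmem
  by_cases hx : f ⟨k, hk⟩ ∈ selected f k
  · have hs : selected f (k + 1) = selected f k := by
      rw [selected, dif_pos hk, if_pos (Or.inr hx)]
    have hu : unhit f (k + 1) = (unhit f k).erase ⟨k, hk⟩ := by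
      ext w
      simp only [unhit, hs, Finset.mem_filter, Finset.mem_univ, true_and, Finset.mem_erase, ne_eq,
        Fin.ext_iff]
      constructor
      · rintro ⟨h1, h2⟩; exact ⟨by omega, by omega, h2⟩
      · rintro ⟨h1, h2, h3⟩; exact ⟨by omega, h3⟩
    rw [increment, if_pos hx, deviation, deviation, hs, hu, ← hcard]
    push_cast; ring
  · have hs : selected f (k + 1) = insert ⟨k, hk⟩ (selected f k) := by
      rw [selected, dif_pos hk, if_neg (by tauto)]
    have hns : (⟨k, hk⟩ : Fin n) ∉ selected f k := fun h' => lt_irrefl _ (lt_of_mem_selected h')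
    have hu : unhit f (k + 1) = ((unhit f k).erase ⟨k, hk⟩).erase (f ⟨k, hk⟩) := by
      ext w
      simp only [unhit, hs, Finset.mem_filter, Finset.mem_univ, true_and, Finset.mem_erase, ne_eq,
        Finset.image_insert, Finset.mem_insert, not_or]
      rw [Fin.ext_iff (b := (⟨k, hk⟩ : Fin n))]
      constructor
      · rintro ⟨h1, h2, h3⟩; exact ⟨h2, by simp only; omega, by omega, h3⟩
      · rintro ⟨h1, h2, h3, h4⟩; exact ⟨by simp only at h2; omega, h1, h4⟩
    rw [increment, if_neg hx, deviation, deviation, hs, hu, Finset.card_insert_of_notMem hns,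
      ← hcard]
    by_cases hW : f ⟨k, hk⟩ ∈ unhit f k ∧ (f ⟨k, hk⟩ : ℕ) ≠ k
    · have : f ⟨k, hk⟩ ∈ (unhit f k).erase ⟨k, hk⟩ :=
        Finset.mem_erase.2 ⟨fun h' => hW.2 (by rw [h']), hW.1⟩
      rw [if_pos hW, ← Finset.card_erase_add_one this]
      push_cast; ring
    · have : f ⟨k, hk⟩ ∉ (unhit f k).erase ⟨k, hk⟩ := fun h' =>
        hW ⟨Finset.mem_of_mem_erase h', fun h'' => (Finset.ne_of_mem_erase h') (Fin.ext h'')⟩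
      rw [if_neg hW, Finset.erase_eq_of_notMem this]
      push_cast; ring

theorem abs_increment_le (f : Fin n → Fin n) (k : ℕ) (x : Fin n) : |increment f k x| ≤ 1 := by
  rw [increment]; split_ifs <;> simp

theorem sum_increment {f : Fin n → Fin n} {k : ℕ} (hk : k < n)
    (h : (⟨k, hk⟩ : Fin n) ∉ (selected f k).image f) :
    ∑ x, increment f k x = 1 - deviation f k := by
  have hmem : (⟨k, hk⟩ : Fin n) ∈ unhit f k := by simpa [unhit] using h
  have hcard := Finset.card_erase_add_one hmem
  have hinc : ∀ x, increment f k x =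
      1 - (if x ∈ selected f k then 2 else 0)
        - (if x ∈ (unhit f k).erase ⟨k, hk⟩ then 1 else 0) := by
    intro x
    have hW : x ∈ (unhit f k).erase ⟨k, hk⟩ ↔ x ∈ unhit f k ∧ (x : ℕ) ≠ k := by
      rw [Finset.mem_erase, and_comm, ne_eq, Fin.ext_iff]
    rw [increment]
    by_cases hx : x ∈ selected f k
    · have : ¬ (x ∈ unhit f k ∧ (x : ℕ) ≠ k) := by
        rintro ⟨h', -⟩
        have := lt_of_mem_selected hx
        simp only [unhit, Finset.mem_filter] at h'
        omega
      rw [if_pos hx, if_pos hx, if_neg (hW.not.2 this)]; norm_num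
    · rw [if_neg hx, if_neg hx]
      by_cases hx' : x ∈ unhit f k ∧ (x : ℕ) ≠ k
      · rw [if_pos hx', if_pos (hW.2 hx')]; norm_num
      · rw [if_neg hx', if_neg (hW.not.2 hx')]; norm_num
  simp only [hinc, Finset.sum_sub_distrib, Finset.sum_ite_mem, Finset.univ_inter,
    Finset.sum_const, nsmul_eq_mul, Finset.card_univ, Fintype.card_fin]
  rw [deviation, ← hcard]
  push_cast; ring

end FunctionalGraph

section Tail

variable {n : ℕ}

theorem sum_eq_sum_update {ι α : Type*} [Fintype ι] [DecidableEq ι] [Fintype α] (v : ι)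
    (g : (ι → α) → ℝ) :
    (Fintype.card α : ℝ) * ∑ f, g f = ∑ f, ∑ x, g (Function.update f v x) := by
  classical
  have e := Fintype.sum_equiv
    (⟨fun p => (Function.update p.1 v p.2, p.1 v), fun p => (Function.update p.1 v p.2, p.1 v),
      fun p => by simp, fun p => by simp⟩ : ((ι → α) × α) ≃ ((ι → α) × α))
    (fun p => g (Function.update p.1 v p.2)) (fun p => g p.1) (fun p => rfl)
  rw [Fintype.sum_prod_type, Fintype.sum_prod_type] at e
  rw [e]
  simp [Finset.mul_sum]

theorem exp_le_one_add_add_sq {y : ℝ} (hy : |y| ≤ 1) : Real.exp y ≤ 1 + y + y ^ 2 := by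
  have := Real.abs_exp_sub_one_sub_id_le hy
  linarith [le_abs_self (Real.exp y - 1 - y)]

theorem sum_exp_deviation_succ_le {k : ℕ} (hk : k < n) {θ : ℝ} (hθ : |θ| ≤ 1)
    (f : Fin n → Fin n) :
    ∑ x, Real.exp (θ * deviation (Function.update f ⟨k, hk⟩ x) (k + 1)) ≤
      n * ((1 + θ ^ 2 + |θ| / n) * Real.exp (θ * deviation f k) + 1 / n) := by
  have hn : (0 : ℝ) < n := by exact_mod_cast (Nat.zero_le k).trans_lt hk
  have hagree : ∀ x, ∀ u : Fin n, (u : ℕ) < k → Function.update f ⟨k, hk⟩ x u = f u := by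
    intro x u hu
    exact Function.update_of_ne (fun h => by rw [h] at hu; exact lt_irrefl _ hu) _ _
  have hsel : ∀ x, selected (Function.update f ⟨k, hk⟩ x) k = selected f k := fun x =>
    selected_congr (hagree x)
  have himg : ∀ x, (selected f k).image (Function.update f ⟨k, hk⟩ x) = (selected f k).image f :=
    fun x => Finset.image_congr fun u hu => hagree x u (lt_of_mem_selected hu)
  have hdev : ∀ x, deviation (Function.update f ⟨k, hk⟩ x) k = deviation f k := fun x =>
    deviation_congr (hagree x)
  set Z := deviation f k
  have hE := Real.exp_pos (θ * Z)
  have hrhs : (n : ℝ) * ((1 + θ ^ 2 + |θ| / n) * Real.exp (θ * Z) + 1 / n) =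
      Real.exp (θ * Z) * (n + n * θ ^ 2 + |θ|) + 1 := by
    field_simp
  rw [hrhs]
  by_cases h : (⟨k, hk⟩ : Fin n) ∈ (selected f k).image f
  · have : ∀ x, deviation (Function.update f ⟨k, hk⟩ x) (k + 1) = Z := fun x => by
      rw [deviation_succ_of_hit hk (by rw [hsel, himg]; exact h), hdev]
    simp only [this, Finset.sum_const, Finset.card_univ, Fintype.card_fin, nsmul_eq_mul]
    have : 0 ≤ Real.exp (θ * Z) * (n * θ ^ 2 + |θ|) := by positivity
    linarith
  · have hstep : ∀ x, deviation (Function.update f ⟨k, hk⟩ x) (k + 1) = Z + increment f k x := by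
      intro x
      rw [deviation_succ_of_not_hit hk (by rw [hsel, himg]; exact h), hdev, Function.update_self]
      simp only [increment, unhit, hsel, himg]
      rfl
    have hbound : ∀ x, Real.exp (θ * (Z + increment f k x)) ≤
        Real.exp (θ * Z) * (1 + θ * increment f k x + θ ^ 2) := by
      intro x
      rw [mul_add, Real.exp_add]
      have hi := abs_increment_le f k x
      have h1 : |θ * increment f k x| ≤ 1 := by
        rw [abs_mul]; exact mul_le_one₀ hθ (abs_nonneg _) hi
      have h2 : (θ * increment f k x) ^ 2 ≤ θ ^ 2 := by
        rw [mul_pow]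
        exact mul_le_of_le_one_right (sq_nonneg _) ((sq_le_one_iff_abs_le_one _).2 hi)
      have := exp_le_one_add_add_sq h1
      gcongr
      linarith
    simp only [hstep]
    refine (Finset.sum_le_sum fun x _ => hbound x).trans ?_
    rw [← Finset.mul_sum, Finset.sum_add_distrib, Finset.sum_add_distrib, ← Finset.mul_sum,
      sum_increment hk h]
    simp only [Finset.sum_const, Finset.card_univ, Fintype.card_fin, nsmul_eq_mul, mul_one]
    have h3 : -(θ * Z) * Real.exp (θ * Z) ≤ 1 := by
      have h4 : -(θ * Z) ≤ Real.exp (-(θ * Z)) := by linarith [Real.add_one_le_exp (-(θ * Z))]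
      calc -(θ * Z) * Real.exp (θ * Z) ≤ Real.exp (-(θ * Z)) * Real.exp (θ * Z) := by gcongr
        _ = 1 := by rw [← Real.exp_add]; simp
    have h5 := mul_le_mul_of_nonneg_left (le_abs_self θ) hE.le
    change Real.exp (θ * Z) * (n + θ * (1 - Z) + n * θ ^ 2) ≤ _
    linarith

theorem sum_exp_deviation_le {θ : ℝ} (hθ : |θ| ≤ 1) {k : ℕ} (hk : k ≤ n) :
    ∑ f : Fin n → Fin n, Real.exp (θ * deviation f k) ≤
      (n : ℝ) ^ n * ((1 + θ ^ 2 + |θ| / n) ^ k * (1 + k / n)) := by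
  induction k with
  | zero => simp [deviation_zero]
  | succ k ih =>
    have hkn : k < n := hk
    have hn : (0 : ℝ) < n := by exact_mod_cast (Nat.zero_le k).trans_lt hkn
    have hi := ih hkn.le
    set a := 1 + θ ^ 2 + |θ| / n with ha_def
    have ha : 1 ≤ a := by
      have : 0 ≤ θ ^ 2 + |θ| / n := by positivity
      linarith
    have e := sum_eq_sum_update (⟨k, hkn⟩ : Fin n)
      (fun f : Fin n → Fin n => Real.exp (θ * deviation f (k + 1)))
    rw [Fintype.card_fin] at e
    have hle := Finset.sum_le_sum fun f (_ : f ∈ (Finset.univ : Finset (Fin n → Fin n))) =>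
      sum_exp_deviation_succ_le hkn hθ f
    rw [← e, ← Finset.mul_sum, Finset.sum_add_distrib, ← Finset.mul_sum] at hle
    have hle' := le_of_mul_le_mul_left hle hn
    simp only [Finset.sum_const, Finset.card_univ, Fintype.card_fun, Fintype.card_fin,
      nsmul_eq_mul, Nat.cast_pow] at hle'
    refine hle'.trans ?_
    have h1 : (1 : ℝ) ≤ a ^ (k + 1) := one_le_pow₀ ha
    have hp : (0 : ℝ) ≤ (n : ℝ) ^ n := by positivity
    calc a * ∑ f : Fin n → Fin n, Real.exp (θ * deviation f k) + (n : ℝ) ^ n * (1 / n)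
        ≤ a * ((n : ℝ) ^ n * (a ^ k * (1 + k / n))) + (n : ℝ) ^ n * (a ^ (k + 1) * (1 / n)) := by
          gcongr
          exact le_mul_of_one_le_left (by positivity) h1
      _ = _ := by push_cast; ring

/-- Maps `f` for which the greedy independent set of `functionalGraph f`, for the natural order,
has a density that is not close to `1 / 2`. -/
noncomputable def atypical (n : ℕ) (ε : ℝ) : Finset (Fin n → Fin n) :=
  open Classical in {f | ε * n < |2 * ((selected f n).card : ℝ) - n|}

theorem card_atypical_le (hn : 0 < n) {ε : ℝ} (hε : 0 < ε) (hε' : ε ≤ 2) :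
    ((atypical n ε).card : ℝ) ≤ n ^ n * (4 * Real.exp (1 - ε ^ 2 / 4 * n)) := by
  have hn' : (0 : ℝ) < n := by exact_mod_cast hn
  set θ := ε / 2 with hθ
  have hθ0 : 0 < θ := by positivity
  have hθ1 : θ ≤ 1 := by linarith
  have hpow : (1 + θ ^ 2 + θ / n) ^ n ≤ Real.exp (θ ^ 2 * n + θ) := by
    calc (1 + θ ^ 2 + θ / n) ^ n ≤ (Real.exp (θ ^ 2 + θ / n)) ^ n := by
          gcongr
          linarith [Real.add_one_le_exp (θ ^ 2 + θ / n)]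
      _ = _ := by rw [← Real.exp_nat_mul]; congr 1; field_simp
  have h1 := sum_exp_deviation_le (n := n) (θ := θ) (by rwa [abs_of_pos hθ0]) le_rfl
  have h2 := sum_exp_deviation_le (n := n) (θ := -θ) (by rwa [abs_neg, abs_of_pos hθ0]) le_rfl
  rw [abs_of_pos hθ0] at h1
  rw [abs_neg, abs_of_pos hθ0, neg_sq] at h2
  rw [div_self hn'.ne'] at h1 h2
  have h3 : (n : ℝ) ^ n * ((1 + θ ^ 2 + θ / n) ^ n * (1 + 1)) ≤
      n ^ n * (2 * Real.exp (θ ^ 2 * n + θ)) := by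
    rw [mul_comm 2]; gcongr; norm_num
  have h4 : ((atypical n ε).card : ℝ) * Real.exp (θ * (ε * n)) ≤
      ∑ f : Fin n → Fin n,
        (Real.exp (θ * deviation f n) + Real.exp (-θ * deviation f n)) := by
    calc ((atypical n ε).card : ℝ) * Real.exp (θ * (ε * n))
        = ∑ f ∈ atypical n ε, Real.exp (θ * (ε * n)) := by simp
      _ ≤ ∑ f ∈ atypical n ε,
          (Real.exp (θ * deviation f n) + Real.exp (-θ * deviation f n)) := by
          refine Finset.sum_le_sum fun f hf => ?_
          have hf' : ε * n < |deviation f n| := by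
            simpa [atypical, deviation_last] using hf
          rcases lt_abs.1 hf' with h | h
          · have : Real.exp (θ * (ε * n)) ≤ Real.exp (θ * deviation f n) := by gcongr
            linarith [Real.exp_pos (-θ * deviation f n)]
          · have : Real.exp (θ * (ε * n)) ≤ Real.exp (-θ * deviation f n) := by
              rw [neg_mul, ← mul_neg]; gcongr
            linarith [Real.exp_pos (θ * deviation f n)]
      _ ≤ _ := Finset.sum_le_univ_sum_of_nonneg fun f => by positivity
  rw [Finset.sum_add_distrib] at h4
  have h5 : ((atypical n ε).card : ℝ) * Real.exp (θ * (ε * n)) ≤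
      n ^ n * (4 * Real.exp (θ ^ 2 * n + θ)) := by linarith
  have h6 : ((atypical n ε).card : ℝ) ≤
      n ^ n * (4 * Real.exp (θ ^ 2 * n + θ)) / Real.exp (θ * (ε * n)) := by
    rwa [le_div_iff₀ (Real.exp_pos _)]
  refine h6.trans ?_
  rw [mul_div_assoc, mul_div_assoc, ← Real.exp_sub]
  have h7 : θ ^ 2 * n + θ - θ * (ε * n) ≤ 1 - ε ^ 2 / 4 * n := by
    have : ε = 2 * θ := by rw [hθ]; ring
    rw [this]; linarith
  have := Real.exp_le_exp.2 h7
  gcongr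

end Tail

section Trees

variable {n : ℕ}

/-- A rank function witnesses that `f` has no cycles besides its fixed points. -/
def IsForestMap {V : Type*} (f : V → V) : Prop :=
  ∃ h : V → ℕ, ∀ v, f v = v ∨ h (f v) < h v

theorem isFixedPt_iterate_of_rank {V : Type*} {f : V → V} {h : V → ℕ}
    (hf : ∀ v, f v = v ∨ h (f v) < h v) (N : ℕ) {v : V} (hv : h v ≤ N) :
    f (f^[N] v) = f^[N] v := by
  induction N generalizing v with
  | zero =>
    rcases hf v with h' | h'
    · exact h'
    · omega
  | succ N ih =>
    rcases hf v with h' | h'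
    · rw [Function.iterate_fixed h', h']
    · rw [Function.iterate_succ_apply]
      exact ih (by omega)

/-- Every forest map on a finite set has a root map. -/
theorem IsForestMap.exists_root {V : Type*} [Finite V] {f : V → V} (hf : IsForestMap f) :
    ∃ N : ℕ, ∀ v, f (f^[N] v) = f^[N] v := by
  obtain ⟨h, hf⟩ := hf
  obtain ⟨N, hN⟩ := (Set.finite_range h).bddAbove
  exact ⟨N, fun v => isFixedPt_iterate_of_rank hf N (hN ⟨v, rfl⟩)⟩

theorem IsForestMap.update {V : Type*} [DecidableEq V] {f : V → V}
    (hf : IsForestMap f) {N : ℕ} (hN : ∀ v, f (f^[N] v) = f^[N] v) {x y : V} (hx : f x = x)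
    (hy : f^[N] y ≠ x) : IsForestMap (Function.update f x y) := by
  classical
  obtain ⟨h, hf⟩ := hf
  refine ⟨fun v => if f^[N] v = x then h v + h y + 1 else h v, fun v => ?_⟩
  beta_reduce
  by_cases hvx : v = x
  · subst hvx
    right
    rw [Function.update_self, if_neg hy, if_pos (Function.iterate_fixed hx N)]
    omega
  · rw [Function.update_of_ne hvx]
    have hroot : f^[N] (f v) = f^[N] v := by
      rw [← Function.iterate_succ_apply, Function.iterate_succ_apply', hN]
    rw [hroot]
    rcases hf v with h' | h'
    · exact Or.inl h'
    · right
      split_ifs <;> omega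

open Classical in
/-- Forest maps with exactly `n - k` roots. -/
noncomputable def forests (n k : ℕ) : Finset (Fin n → Fin n) :=
  {f | IsForestMap f ∧ (Finset.univ.filter fun v => f v = v).card = n - k}

theorem card_forests_succ {k : ℕ} (hk : k + 1 ≤ n) :
    (forests n k).card * (n * (n - (k + 1))) ≤ (forests n (k + 1)).card * (k + 1) := by
  classical
  have hex : ∀ f : Fin n → Fin n, ∃ N, f ∈ forests n k → ∀ v, f (f^[N] v) = f^[N] v := by
    intro f
    by_cases h : f ∈ forests n k
    · obtain ⟨N, hN⟩ := (Finset.mem_filter.1 h).2.1.exists_root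
      exact ⟨N, fun _ => hN⟩
    · exact ⟨0, fun h' => absurd h' h⟩
  choose N hN using hex
  let A : Finset (Σ _ : (Σ _ : Fin n → Fin n, Fin n), Fin n) :=
    ((forests n k).sigma fun _ => Finset.univ).sigma fun p =>
      ((Finset.univ.filter fun v => p.1 v = v).erase (p.1^[N p.1] p.2))
  let B : Finset (Σ _ : Fin n → Fin n, Fin n) :=
    (forests n (k + 1)).sigma fun f => (Finset.univ.filter fun v => f v ≠ v)
  have hA : A.card = (forests n k).card * (n * (n - (k + 1))) := by
    simp only [A, Finset.card_sigma]
    rw [Finset.sum_congr rfl (g := fun _ => n - (k + 1))]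
    · simp; ring
    · rintro ⟨f, y⟩ hp
      have hf : f ∈ forests n k := (Finset.mem_sigma.1 hp).1
      rw [Finset.card_erase_of_mem (by simpa using hN f hf y)]
      have : (Finset.univ.filter fun v => f v = v).card = n - k := (Finset.mem_filter.1 hf).2.2
      change (Finset.univ.filter fun v => f v = v).card - 1 = _
      omega
  have hB : B.card = (forests n (k + 1)).card * (k + 1) := by
    simp only [B, Finset.card_sigma]
    rw [Finset.sum_congr rfl (g := fun _ => k + 1)]
    · simp
    · intro f hf
      have h1 := (Finset.mem_filter.1 hf).2.2
      have h2 := Finset.card_filter_add_card_filter_not (s := (Finset.univ : Finset (Fin n)))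
        (fun v => f v = v)
      rw [Finset.card_univ, Fintype.card_fin] at h2
      simp only [ne_eq]
      omega
  rw [← hA, ← hB]
  refine Finset.card_le_card_of_injOn
    (fun p => ⟨Function.update p.1.1 p.2 p.1.2, p.2⟩) ?_ ?_
  · rintro ⟨⟨f, y⟩, x⟩ hp
    obtain ⟨hp1, hp2⟩ := Finset.mem_sigma.1 hp
    have hf : f ∈ forests n k := (Finset.mem_sigma.1 hp1).1
    obtain ⟨hne, hfix⟩ := Finset.mem_erase.1 hp2
    simp only [Finset.mem_filter, Finset.mem_univ, true_and] at hne hfix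
    have hyx : y ≠ x := by
      rintro rfl
      exact hne (Function.iterate_fixed hfix _).symm
    refine Finset.mem_coe.2 (Finset.mem_sigma.2 ⟨Finset.mem_filter.2 ⟨Finset.mem_univ _,
      (Finset.mem_filter.1 hf).2.1.update (hN f hf) hfix hne.symm, ?_⟩, ?_⟩)
    · have : (Finset.univ.filter fun v => Function.update f x y v = v) =
          (Finset.univ.filter fun v => f v = v).erase x := by
        ext v
        simp only [Finset.mem_filter, Finset.mem_univ, true_and, Finset.mem_erase]
        by_cases hv : v = x
        · subst hv; simp [hyx]
        · simp [hv]
      change (Finset.univ.filter fun v => Function.update f x y v = v).card = _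
      rw [this, Finset.card_erase_of_mem (by simpa using hfix), (Finset.mem_filter.1 hf).2.2]
      omega
    · simpa using hyx
  · rintro ⟨⟨f, y⟩, x⟩ hp ⟨⟨f', y'⟩, x'⟩ hp' heq
    simp only [Sigma.mk.injEq, heq_eq_eq] at heq
    obtain ⟨h1, rfl⟩ := heq
    have hfix : f x = x := by
      simpa using (Finset.mem_erase.1 (Finset.mem_sigma.1 (Finset.mem_coe.1 hp)).2).2
    have hfix' : f' x = x := by
      simpa using (Finset.mem_erase.1 (Finset.mem_sigma.1 (Finset.mem_coe.1 hp')).2).2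
    have hy : y = y' := by simpa using congrFun h1 x
    have hff : f = f' := by
      funext v
      by_cases hv : v = x
      · rw [hv, hfix, hfix']
      · simpa [hv] using congrFun h1 v
    subst hy hff
    rfl

theorem pow_mul_descFactorial_le_card_forests {k : ℕ} (hk : k + 1 ≤ n) :
    n ^ k * (n - 1).descFactorial k ≤ (forests n k).card * k.factorial := by
  classical
  induction k with
  | zero =>
    have : id ∈ forests n 0 :=
      Finset.mem_filter.2 ⟨Finset.mem_univ _, ⟨0, fun v => Or.inl rfl⟩, by simp⟩
    simpa using Finset.card_pos.2 ⟨_, this⟩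
  | succ k ih =>
    have h1 := ih (by omega)
    have h2 := card_forests_succ (n := n) (k := k) (by omega)
    rw [Nat.descFactorial_succ, Nat.factorial_succ]
    calc n ^ (k + 1) * ((n - 1 - k) * (n - 1).descFactorial k)
        = (n ^ k * (n - 1).descFactorial k) * (n * (n - (k + 1))) := by
          rw [show n - (k + 1) = n - 1 - k by omega]; ring
      _ ≤ ((forests n k).card * k.factorial) * (n * (n - (k + 1))) := by gcongr
      _ = ((forests n k).card * (n * (n - (k + 1)))) * k.factorial := by ring
      _ ≤ ((forests n (k + 1)).card * (k + 1)) * k.factorial := by gcongr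
      _ = _ := by ring

/-- The number of rooted labelled trees is at least `n ^ (n - 1)`. -/
theorem pow_le_card_forests (hn : 0 < n) : n ^ (n - 1) ≤ (forests n (n - 1)).card := by
  have h := pow_mul_descFactorial_le_card_forests (n := n) (k := n - 1) (by omega)
  rw [Nat.descFactorial_self] at h
  exact Nat.le_of_mul_le_mul_right h (Nat.factorial_pos _)

theorem exists_root_of_mem_forests {f : Fin n → Fin n} (hn : 0 < n)
    (hf : f ∈ forests n (n - 1)) :
    ∃ r, ∀ v, f v = v ↔ v = r := by
  classical
  have h := (Finset.mem_filter.1 hf).2.2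
  rw [show n - (n - 1) = 1 by omega, Finset.card_eq_one] at h
  obtain ⟨r, hr⟩ := h
  refine ⟨r, fun v => ?_⟩
  have := Finset.ext_iff.1 hr v
  simpa using this

theorem functionalGraph_isTree {f : Fin n → Fin n} (hn : 0 < n) (hf : f ∈ forests n (n - 1)) :
    (functionalGraph f).IsTree := by
  classical
  obtain ⟨r, hr⟩ := exists_root_of_mem_forests hn hf
  obtain ⟨h, hrank⟩ := (Finset.mem_filter.1 hf).2.1
  have hreach : ∀ m v, h v ≤ m → (functionalGraph f).Reachable v r := by
    intro m
    induction m with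
    | zero =>
      intro v hv
      rcases hrank v with h' | h'
      · rw [(hr v).1 h']
      · omega
    | succ m ih =>
      intro v hv
      rcases hrank v with h' | h'
      · rw [(hr v).1 h']
      · refine SimpleGraph.Reachable.trans (SimpleGraph.Adj.reachable ?_) (ih (f v) (by omega))
        refine functionalGraph_adj.2 ⟨fun h'' => ?_, Or.inl rfl⟩
        rw [← h''] at h'
        exact lt_irrefl _ h'
  have hconn : (functionalGraph f).Connected :=
    { preconnected := fun u v => (hreach _ u le_rfl).trans (hreach _ v le_rfl).symm
      nonempty := ⟨r⟩ }
  refine SimpleGraph.isTree_iff_connected_and_card.2 ⟨hconn, le_antisymm ?_ ?_⟩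
  · have hsub : (functionalGraph f).edgeSet ⊆
        ((Finset.univ.erase r).image fun v => s(v, f v) : Finset (Sym2 (Fin n))) := by
      intro e he
      induction e with
      | _ u v =>
        obtain ⟨hne, h'⟩ := functionalGraph_adj.1 he
        rw [Finset.mem_coe, Finset.mem_image]
        rcases h' with h' | h'
        · refine ⟨u, Finset.mem_erase.2 ⟨fun hu => hne ?_, Finset.mem_univ _⟩, by rw [h']⟩
          rw [← h', (hr u).2 hu]
        · refine ⟨v, Finset.mem_erase.2 ⟨fun hv => hne ?_, Finset.mem_univ _⟩, by
            rw [h', Sym2.eq_swap]⟩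
          rw [← h', (hr v).2 hv]
    have h1 := Set.ncard_le_ncard hsub (Finset.finite_toSet _)
    rw [Set.ncard_coe_finset] at h1
    have h2 := h1.trans Finset.card_image_le
    rw [Finset.card_erase_of_mem (Finset.mem_univ _), Finset.card_univ, Fintype.card_fin] at h2
    rw [Nat.card_coe_set_eq, Nat.card_eq_fintype_card, Fintype.card_fin]
    omega
  · exact hconn.card_vert_le_card_edgeSet_add_one

theorem eq_of_functionalGraph_eq {f g : Fin n → Fin n} {r : Fin n} {h : Fin n → ℕ}
    (hrank : ∀ v, f v = v ∨ h (f v) < h v) (hf : ∀ v, f v = v ↔ v = r)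
    (hg : ∀ v, g v = v ↔ v = r)
    (hfg : functionalGraph f = functionalGraph g) : f = g := by
  have hedge : ∀ v, v ≠ r → g v = f v ∨ g (f v) = v := by
    intro v hv
    have : (functionalGraph f).Adj v (f v) :=
      functionalGraph_adj.2 ⟨fun h' => hv ((hf v).1 h'.symm), Or.inl rfl⟩
    rw [hfg] at this
    exact (functionalGraph_adj.1 this).2
  have key : ∀ m v, h v ≤ m → v ≠ r → g (f v) ≠ v := by
    intro m
    induction m with
    | zero =>
      intro v hv hvr
      rcases hrank v with h' | h'
      · exact absurd ((hf v).1 h') hvr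
      · omega
    | succ m ih =>
      intro v hv hvr hgv
      rcases hrank v with h' | h'
      · exact hvr ((hf v).1 h')
      by_cases hfr : f v = r
      · rw [(hg _).2 hfr] at hgv
        exact hvr (hgv ▸ hfr)
      · rcases hedge _ hfr with h'' | h''
        · rw [hgv] at h''
          rcases hrank (f v) with h3 | h3
          · exact hfr ((hf _).1 h3)
          · rw [← h''] at h3; omega
        · exact ih _ (by omega) hfr h''
  funext v
  by_cases hv : v = r
  · rw [(hf v).2 hv, (hg v).2 hv]
  · exact ((hedge v hv).resolve_right (key _ v le_rfl hv)).symm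

/-- The labelled trees on `n` vertices. -/
noncomputable abbrev labelledTrees (n : ℕ) : Finset (SimpleGraph (Fin n)) :=
  (Set.toFinite {G : SimpleGraph (Fin n) | G.IsTree}).toFinset

theorem card_forests_le (hn : 0 < n) :
    (forests n (n - 1)).card ≤ (labelledTrees n).card * n := by
  classical
  have hex : ∀ f : Fin n → Fin n, ∃ r, f ∈ forests n (n - 1) → ∀ v, f v = v ↔ v = r := by
    intro f
    by_cases h : f ∈ forests n (n - 1)
    · obtain ⟨r, hr⟩ := exists_root_of_mem_forests hn h
      exact ⟨r, fun _ => hr⟩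
    · exact ⟨⟨0, hn⟩, fun h' => absurd h' h⟩
  choose r hr using hex
  have : (labelledTrees n).card * n = (labelledTrees n ×ˢ (Finset.univ : Finset (Fin n))).card := by
    simp
  rw [this]
  refine Finset.card_le_card_of_injOn (fun f => (functionalGraph f, r f)) ?_ ?_
  · intro f hf
    simpa using functionalGraph_isTree hn hf
  · intro f hf g hg heq
    simp only [Prod.mk.injEq] at heq
    obtain ⟨h, hrank⟩ := (Finset.mem_filter.1 hf).2.1
    exact eq_of_functionalGraph_eq hrank (hr f hf) (fun v => by rw [heq.2]; exact hr g hg v) heq.1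

theorem pow_le_card_labelledTrees (hn : 0 < n) : n ^ n ≤ (labelledTrees n).card * n ^ 2 := by
  have h := (pow_le_card_forests hn).trans (card_forests_le hn)
  calc n ^ n = n ^ (n - 1) * n := by rw [← pow_succ, Nat.sub_add_cancel hn]
    _ ≤ (labelledTrees n).card * n * n := by gcongr
    _ = _ := by ring

/-- Every tree is the graph of the map that moves each vertex towards a fixed root. -/
theorem exists_functionalGraph_eq (hn : 0 < n) {G : SimpleGraph (Fin n)} (hG : G.IsTree) :
    ∃ f, functionalGraph f = G := by
  classical
  let r : Fin n := ⟨0, hn⟩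
  have hex : ∀ v, ∃ w, v ≠ r → G.Adj v w ∧ G.dist w r < G.dist v r := by
    intro v
    by_cases hv : v = r
    · exact ⟨v, fun h => absurd hv h⟩
    · obtain ⟨p, hp⟩ := hG.connected.exists_walk_length_eq_dist v r
      cases p with
      | nil => exact absurd rfl hv
      | cons hadj q =>
        refine ⟨_, fun _ => ⟨hadj, ?_⟩⟩
        rw [SimpleGraph.Walk.length_cons] at hp
        have := SimpleGraph.dist_le q
        omega
  choose g hg using hex
  let f : Fin n → Fin n := fun v => if v = r then r else g v
  have hle : functionalGraph f ≤ G := by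
    intro u v huv
    obtain ⟨hne, h⟩ := functionalGraph_adj.1 huv
    rcases h with h | h
    · by_cases hu : u = r
      · simp only [f, if_pos hu] at h
        exact absurd (hu.trans h) hne
      · simp only [f, if_neg hu] at h
        exact h ▸ (hg u hu).1
    · by_cases hv : v = r
      · simp only [f, if_pos hv] at h
        exact absurd (hv.trans h).symm hne
      · simp only [f, if_neg hv] at h
        exact h ▸ (hg v hv).1.symm
  have hreach : ∀ m v, G.dist v r ≤ m → (functionalGraph f).Reachable v r := by
    intro m
    induction m with
    | zero =>
      intro v hv
      rw [(hG.connected v r).dist_eq_zero_iff.1 (by omega)]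
    | succ m ih =>
      intro v hv
      by_cases hvr : v = r
      · rw [hvr]
      · have h := hg v hvr
        refine SimpleGraph.Reachable.trans (SimpleGraph.Adj.reachable ?_) (ih (g v) (by omega))
        exact functionalGraph_adj.2 ⟨h.1.ne, Or.inl (if_neg hvr)⟩
  have hconn : (functionalGraph f).Connected :=
    { preconnected := fun u v => (hreach _ u le_rfl).trans (hreach _ v le_rfl).symm
      nonempty := ⟨r⟩ }
  exact ⟨f, le_antisymm hle ((SimpleGraph.isTree_iff_minimal_connected.1 hG).2 hconn hle)⟩

end Trees

section Whp

variable {n : ℕ}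

theorem card_atypical_conj (ε : ℝ) (π : Equiv.Perm (Fin n)) :
    open Classical in
    (Finset.univ.filter fun f : Fin n → Fin n => π.symm ∘ f ∘ π ∈ atypical n ε).card =
      (atypical n ε).card := by
  classical
  refine Finset.card_bij (fun f _ => π.symm ∘ f ∘ π) (fun f hf => (Finset.mem_filter.1 hf).2) ?_ ?_
  · intro f _ g _ h
    funext v
    simpa using congrFun h (π.symm v)
  · intro g hg
    have h : π.symm ∘ (π ∘ g ∘ π.symm) ∘ π = g := by funext v; simp
    exact ⟨π ∘ g ∘ π.symm, Finset.mem_filter.2 ⟨Finset.mem_univ _, h.symm ▸ hg⟩, h⟩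

theorem greedyRatioLaw_apply_le (p : PMF (SimpleGraph (Fin n))) {B : Set ℝ} (hB : MeasurableSet B)
    {c : ℝ≥0∞}
    (h : ∀ π, (p.map fun G => greedyRatio G π).toMeasure B ≤ c) :
    (greedyRatioLaw p).toMeasure B ≤ c := by
  have : greedyRatioLaw p = (PMF.uniformOfFintype (Equiv.Perm (Fin n))).bind
      fun π => p.map fun G => greedyRatio G π := by
    simp only [greedyRatioLaw, PMF.map]
    exact PMF.bind_comm _ _ _
  rw [this, PMF.toMeasure_bind_apply _ _ _ hB]
  calc ∑' π, (PMF.uniformOfFintype (Equiv.Perm (Fin n))) π *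
        (p.map fun G => greedyRatio G π).toMeasure B
      ≤ ∑' π, (PMF.uniformOfFintype (Equiv.Perm (Fin n))) π * c :=
        ENNReal.tsum_le_tsum fun π => mul_le_mul_right (h π) _
    _ = c := by rw [ENNReal.tsum_mul_right, PMF.tsum_coe, one_mul]

theorem measurableSet_deviating (c ε : ℝ) : MeasurableSet {x : ℝ | |x / c - 1| ≤ ε}ᶜ := by
  apply MeasurableSet.compl
  exact measurableSet_le (by fun_prop) measurable_const

theorem asympWhp_of_compl_le {L : ℕ → PMF ℝ} {c : ℝ}
    (h : ∀ ε : ℝ, 0 < ε → ε ≤ 2 → ∃ u : ℕ → ℝ, Tendsto u atTop (𝓝 0) ∧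
      ∀ n, (L n).toMeasure {x : ℝ | |x / c - 1| ≤ ε}ᶜ ≤ ENNReal.ofReal (u n)) :
    AsympWhp L c := by
  intro ε hε
  obtain ⟨u, hu, hle⟩ := h (min ε 2) (by positivity) (min_le_right _ _)
  have hu' : Tendsto (fun n => 1 - ENNReal.ofReal (u n)) atTop (𝓝 1) := by
    have := ENNReal.Tendsto.sub (tendsto_const_nhds (x := (1 : ℝ≥0∞))) (ENNReal.tendsto_ofReal hu)
      (Or.inl ENNReal.one_ne_top)
    simpa using this
  refine tendsto_of_tendsto_of_tendsto_of_le_of_le hu' tendsto_const_nhds (fun n => ?_)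
    (fun n => prob_le_one)
  have hsub : {x : ℝ | |x / c - 1| ≤ min ε 2} ⊆ {x : ℝ | |x / c - 1| ≤ ε} := fun x hx =>
    show |x / c - 1| ≤ ε from le_trans hx (min_le_left _ _)
  refine le_trans ?_ (measure_mono hsub)
  have hm := (measurableSet_deviating c (min ε 2)).compl
  rw [compl_compl] at hm
  have h1 := prob_compl_eq_one_sub hm.compl (μ := (L n).toMeasure)
  rw [compl_compl] at h1
  rw [h1]
  exact tsub_le_tsub_left (hle n) 1

theorem greedyRatio_mem_deviating_iff (hn : 0 < n) (ε : ℝ) (f : Fin n → Fin n)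
    (π : Equiv.Perm (Fin n)) :
    greedyRatio (functionalGraph f) π ∈ {x : ℝ | |x / (1 / 2) - 1| ≤ ε}ᶜ ↔
      π.symm ∘ f ∘ π ∈ atypical n ε := by
  have hn' : (0 : ℝ) < n := by exact_mod_cast hn
  rw [greedyRatio_functionalGraph, Set.mem_compl_iff, Set.mem_ofPred_eq, not_le]
  simp only [atypical, Finset.mem_filter, Finset.mem_univ, true_and]
  set s := ((selected (π.symm ∘ f ∘ π) n).card : ℝ)
  have : s / n / (1 / 2) - 1 = (2 * s - n) / n := by field_simp
  rw [this, abs_div, abs_of_pos hn', lt_div_iff₀ hn']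

theorem randomFunctionalGraph_deviating_le [NeZero n] {ε : ℝ} (hε : 0 < ε) (hε' : ε ≤ 2) :
    (greedyRatioLaw (randomFunctionalGraph n)).toMeasure {x : ℝ | |x / (1 / 2) - 1| ≤ ε}ᶜ ≤
      ENNReal.ofReal (4 * Real.exp (1 - ε ^ 2 / 4 * n)) := by
  classical
  have hn : 0 < n := NeZero.pos n
  refine greedyRatioLaw_apply_le _ (measurableSet_deviating _ _) fun π => ?_
  rw [randomFunctionalGraph, PMF.map_comp,
    PMF.toMeasure_apply_eq_toOuterMeasure_apply _ (measurableSet_deviating _ _),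
    PMF.toOuterMeasure_map_apply, PMF.uniformOfFintype, PMF.toOuterMeasure_uniformOfFinset_apply]
  have hcard : (Finset.univ.filter fun f : Fin n → Fin n => f ∈
      ((fun G => greedyRatio G π) ∘ functionalGraph) ⁻¹' {x : ℝ | |x / (1 / 2) - 1| ≤ ε}ᶜ).card =
      (atypical n ε).card := by
    rw [← card_atypical_conj ε π]
    congr 1
    ext f
    simp only [Finset.mem_filter, Finset.mem_univ, true_and]
    exact greedyRatio_mem_deviating_iff hn ε f π
  rw [hcard, Finset.card_univ, Fintype.card_fun, Fintype.card_fin]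
  refine ENNReal.div_le_of_le_mul ?_
  rw [← ENNReal.ofReal_natCast, ← ENNReal.ofReal_natCast, ← ENNReal.ofReal_mul (by positivity)]
  refine ENNReal.ofReal_le_ofReal ?_
  rw [mul_comm]
  exact_mod_cast card_atypical_le hn hε hε'

theorem uniformTree_deviating_le [NeZero n] {ε : ℝ} (hε : 0 < ε) (hε' : ε ≤ 2) :
    (greedyRatioLaw (uniformTree n)).toMeasure {x : ℝ | |x / (1 / 2) - 1| ≤ ε}ᶜ ≤
      ENNReal.ofReal (n ^ 2 * (4 * Real.exp (1 - ε ^ 2 / 4 * n))) := by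
  classical
  have hn : 0 < n := NeZero.pos n
  refine greedyRatioLaw_apply_le _ (measurableSet_deviating _ _) fun π => ?_
  rw [PMF.toMeasure_apply_eq_toOuterMeasure_apply _ (measurableSet_deviating _ _),
    PMF.toOuterMeasure_map_apply, uniformTree, PMF.toOuterMeasure_uniformOfFinset_apply]
  have hcard : ((labelledTrees n).filter fun G => G ∈
      (fun G => greedyRatio G π) ⁻¹' {x : ℝ | |x / (1 / 2) - 1| ≤ ε}ᶜ).card ≤
      (atypical n ε).card := by
    rw [← card_atypical_conj ε π]
    refine (Finset.card_le_card ?_).trans (Finset.card_image_le (f := functionalGraph))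
    intro G hG
    obtain ⟨hT, hdev⟩ := Finset.mem_filter.1 hG
    obtain ⟨f, rfl⟩ := exists_functionalGraph_eq hn (by simpa using hT)
    exact Finset.mem_image.2 ⟨f, Finset.mem_filter.2 ⟨Finset.mem_univ _,
      (greedyRatio_mem_deviating_iff hn ε f π).1 hdev⟩, rfl⟩
  refine ENNReal.div_le_of_le_mul ?_
  refine le_trans (Nat.cast_le.2 hcard) ?_
  rw [← ENNReal.ofReal_natCast, ← ENNReal.ofReal_natCast, ← ENNReal.ofReal_mul (by positivity)]
  refine ENNReal.ofReal_le_ofReal ?_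
  have h1 : (n : ℝ) ^ n ≤ (labelledTrees n).card * (n : ℝ) ^ 2 := by
    exact_mod_cast pow_le_card_labelledTrees hn
  calc ((atypical n ε).card : ℝ) ≤ (n : ℝ) ^ n * (4 * Real.exp (1 - ε ^ 2 / 4 * n)) :=
        card_atypical_le hn hε hε'
    _ ≤ ((labelledTrees n).card * (n : ℝ) ^ 2) * (4 * Real.exp (1 - ε ^ 2 / 4 * n)) := by gcongr
    _ = _ := by ring

theorem tendsto_sq_mul_exp_neg {ε : ℝ} (hε : 0 < ε) :
    Tendsto (fun n : ℕ => ((n + 1 : ℕ) : ℝ) ^ 2 *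
      (4 * Real.exp (1 - ε ^ 2 / 4 * ((n + 1 : ℕ) : ℝ)))) atTop (𝓝 0) := by
  have h := (tendsto_rpow_mul_exp_neg_mul_atTop_nhds_zero 2 (ε ^ 2 / 4) (by positivity)).comp
    (tendsto_natCast_atTop_atTop.comp (tendsto_add_atTop_nat 1))
  have h' := h.const_mul (4 * Real.exp 1)
  rw [mul_zero] at h'
  refine h'.congr fun n => ?_
  simp only [Function.comp_apply, Real.rpow_two]
  rw [sub_eq_add_neg, Real.exp_add, ← neg_mul]
  ring

theorem asympWhp_uniformTree :
    AsympWhp (fun n => greedyRatioLaw (uniformTree (n + 1))) (1 / 2) :=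
  asympWhp_of_compl_le fun _ hε hε' =>
    ⟨_, tendsto_sq_mul_exp_neg hε, fun _ => uniformTree_deviating_le hε hε'⟩

theorem asympWhp_randomFunctionalGraph :
    AsympWhp (fun n => greedyRatioLaw (randomFunctionalGraph (n + 1))) (1 / 2) :=
  asympWhp_of_compl_le fun _ hε hε' =>
    ⟨_, tendsto_sq_mul_exp_neg hε, fun n => (randomFunctionalGraph_deviating_le hε hε').trans
      (ENNReal.ofReal_le_ofReal (le_mul_of_one_le_left (by positivity)
        (one_le_pow₀ (by exact_mod_cast n.succ_pos))))⟩

end Whp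

/-- A set that satisfies the greedy recursion along a sorted list is the greedy set. -/
theorem greedySet_eq_of_recursion {V : Type*} {G : SimpleGraph V} {σ : V → unitInterval}
    {P : V → Prop} {l : List V} (hl : l.Pairwise fun u v => σ u < σ v)
    (hP : ∀ v ∈ l, P v ↔ ∀ u ∈ l, σ u < σ v → G.Adj u v → ¬ P u) :
    greedySet G l = {v | v ∈ l ∧ P v} := by
  induction l using List.reverseRecOn with
  | nil => ext; simp [greedySet]
  | append_singleton l v ih =>
    obtain ⟨hl', -, hlast⟩ := List.pairwise_append.1 hl
    have hlast' : ∀ u ∈ l, σ u < σ v := fun u hu => hlast u hu v (by simp)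
    have ih' := ih hl' fun w hw => by
      rw [hP w (by simp [hw])]
      constructor
      · intro h u hu
        exact h u (by simp [hu])
      · intro h u hu huw
        rcases List.mem_append.1 hu with hu | hu
        · exact h u hu huw
        · obtain rfl : u = v := by simpa using hu
          exact absurd huw (hlast' w hw).not_gt
    have hv : P v ↔ ∀ u ∈ l, P u → ¬ G.Adj u v := by
      rw [hP v (by simp)]
      constructor
      · intro h u hu hPu hadj
        exact h u (by simp [hu]) (hlast' u hu) hadj hPu
      · intro h u hu huv hadj hPu
        rcases List.mem_append.1 hu with hu | hu
        · exact h u hu hPu hadj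
        · obtain rfl : u = v := by simpa using hu
          exact lt_irrefl _ huv
    rw [greedySet_concat, ih']
    ext w
    simp only [Set.mem_union, Set.mem_ofPred_eq, List.mem_append, List.mem_singleton, and_imp]
    constructor
    · rintro (⟨h1, h2⟩ | ⟨rfl, h⟩)
      · exact ⟨Or.inl h1, h2⟩
      · exact ⟨Or.inr rfl, hv.2 h⟩
    · rintro ⟨h1 | rfl, h2⟩
      · exact Or.inl ⟨h1, h2⟩
      · exact Or.inr ⟨rfl, hv.1 h2⟩

theorem exists_isArrivalOrder {V : Type*} {σ : V → unitInterval} (hσ : Function.Injective σ)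
    {S : Set V} (hS : S.Finite) : ∃ l, IsArrivalOrder σ S l := by
  classical
  rcases isEmpty_or_nonempty V with hV | hV
  · exact ⟨[], by simp, fun v => hV.elim v⟩
  have hinv : ∀ v, Function.invFun σ (σ v) = v := Function.leftInverse_invFun hσ
  have hmem : ∀ x ∈ (hS.toFinset.image σ).sort (· ≤ ·), ∃ v ∈ S, σ v = x := by
    intro x hx
    simpa using hx
  refine ⟨((hS.toFinset.image σ).sort (· ≤ ·)).map (Function.invFun σ), ?_, fun v => ?_⟩
  · rw [List.pairwise_map]
    have := (Finset.sortedLT_sort (hS.toFinset.image σ)).pairwise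
    refine this.imp_of_mem fun {a b} ha hb hab => ?_
    obtain ⟨u, -, rfl⟩ := hmem a ha
    obtain ⟨w, -, rfl⟩ := hmem b hb
    rwa [hinv, hinv]
  · rw [List.mem_map]
    constructor
    · rintro ⟨x, hx, rfl⟩
      obtain ⟨u, hu, rfl⟩ := hmem x hx
      rwa [hinv]
    · intro hv
      exact ⟨σ v, by simpa using ⟨v, hv, rfl⟩, hinv v⟩

section Deterministic

variable {T : Type*}

/-- The offspring numbers and the labels of all potential vertices. -/
abbrev Config (T : Type*) := Node T → (T → ℕ) × unitInterval

/-- The data of the subtree of `v`. -/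
def subtree (v : Node T) (ω : Config T) : Config T := fun u => ω (u ++ v)

/-- The configurations for which no child of the root that is present and has a smaller label than
the root carries a subtree in `A`. -/
def rootFree (A : Set (Config T)) : Set (Config T) :=
  {ω | ∀ c : T × ℕ, c.2 < (ω []).1 c.1 → (ω [c]).2 < (ω []).2 → subtree [c] ω ∉ A}

/-- Occupation of the root, computed up to depth `k`. -/
def occupiedUpTo (T : Type*) : ℕ → Set (Config T)
  | 0 => ∅
  | k + 1 => rootFree (occupiedUpTo T k)

/-- The past of the root has depth less than `k`. -/
def pastDepthLT (T : Type*) : ℕ → Set (Config T)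
  | 0 => ∅
  | k + 1 => rootFree (pastDepthLT T k)ᶜ

theorem subtree_nil (ω : Config T) : subtree [] ω = ω := by
  funext u
  simp [subtree]

theorem subtree_subtree (c : T × ℕ) (v : Node T) (ω : Config T) :
    subtree [c] (subtree v ω) = subtree (c :: v) ω := by
  funext u
  simp [subtree]

theorem subtree_mem_rootFree {A : Set (Config T)} {v : Node T} {ω : Config T} :
    subtree v ω ∈ rootFree A ↔ ∀ c : T × ℕ, c.2 < (ω v).1 c.1 → (ω (c :: v)).2 < (ω v).2 →
      subtree (c :: v) ω ∉ A := by
  refine forall_congr' fun c => ?_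
  rw [← subtree_subtree c v]
  rfl

theorem rootFree_anti {A B : Set (Config T)} (h : A ⊆ B) : rootFree B ⊆ rootFree A :=
  fun _ hω c h1 h2 hA => hω c h1 h2 (h hA)

theorem pastDepthLT_mono_succ (k : ℕ) : pastDepthLT T k ⊆ pastDepthLT T (k + 1) := by
  induction k with
  | zero => exact Set.empty_subset _
  | succ k ih => exact rootFree_anti (Set.compl_subset_compl.2 ih)

theorem pastDepthLT_mono : Monotone (pastDepthLT T) :=
  monotone_nat_of_le_succ pastDepthLT_mono_succ

theorem occupiedUpTo_succ_iff {k : ℕ} {ω : Config T} (hω : ω ∈ pastDepthLT T k) :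
    ω ∈ occupiedUpTo T (k + 1) ↔ ω ∈ occupiedUpTo T k := by
  induction k generalizing ω with
  | zero => exact absurd hω (Set.notMem_empty _)
  | succ k ih =>
    refine forall_congr' fun c => forall_congr' fun h1 => forall_congr' fun h2 => not_congr ?_
    exact ih (not_not.1 (hω c h1 h2))

/-- The vertices that are reachable from the root by descending to present children with smaller
and smaller labels. -/
def Descends (ω : Config T) : Node T → Prop
  | [] => True
  | c :: v => Descends ω v ∧ c.2 < (ω v).1 c.1 ∧ (ω (c :: v)).2 < (ω v).2

theorem Descends.inTree {ω : Config T} {v : Node T} (h : Descends ω v) :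
    InTree (fun u => (ω u).1) v := by
  induction v with
  | nil => trivial
  | cons c v ih => exact ⟨ih h.1, h.2.1⟩

theorem branchingTree_adj {ξ : Node T → T → ℕ} {u v : Node T} :
    (branchingTree ξ).Adj u v ↔
      (InTree ξ v ∧ ∃ c : T × ℕ, v = c :: u) ∨ (InTree ξ u ∧ ∃ c : T × ℕ, u = c :: v) := by
  rw [branchingTree, SimpleGraph.fromRel_adj]
  refine ⟨fun h => h.2, fun h => ⟨?_, h⟩⟩
  rintro rfl
  rcases h with ⟨-, c, h⟩ | ⟨-, c, h⟩ <;> simpa using congrArg List.length h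

theorem past_eq (ω : Config T) :
    past (branchingTree fun v => (ω v).1) (fun v => (ω v).2) [] = {v | Descends ω v} := by
  ext w
  constructor
  · intro h
    induction h with
    | refl => trivial
    | @tail a b _ hab ih =>
      obtain ⟨hadj, hlt⟩ := hab
      rcases branchingTree_adj.1 hadj with ⟨hin, c, rfl⟩ | ⟨-, c, rfl⟩
      · exact ⟨ih, hin.2, hlt⟩
      · exact absurd hlt (ih.2.2).not_gt
  · intro h
    induction w with
    | nil => exact Relation.ReflTransGen.refl
    | cons c v ih =>
      exact Relation.ReflTransGen.tail (ih h.1)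
        ⟨branchingTree_adj.2 (Or.inl ⟨Descends.inTree h, c, rfl⟩), h.2.2⟩

theorem Descends.length_lt {ω : Config T} {k : ℕ} (hω : ω ∈ pastDepthLT T k) {v : Node T}
    (h : Descends ω v) : v.length < k ∧ subtree v ω ∈ pastDepthLT T (k - v.length) := by
  induction v with
  | nil =>
    refine ⟨Nat.pos_of_ne_zero ?_, by simpa [subtree_nil] using hω⟩
    rintro rfl
    exact hω
  | cons c v ih =>
    obtain ⟨h1, h2⟩ := ih h.1
    obtain ⟨m, hm⟩ : ∃ m, k - v.length = m + 1 := ⟨k - v.length - 1, by omega⟩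
    rw [hm] at h2
    have h3 := not_not.1 (subtree_mem_rootFree.1 h2 c h.2.1 h.2.2)
    have hm' : k - (c :: v).length = m := by rw [List.length_cons]; omega
    rw [hm']
    refine ⟨?_, h3⟩
    rcases m with _ | m
    · exact absurd h3 (Set.notMem_empty _)
    · rw [List.length_cons]; omega

theorem finite_descends_length [Finite T] (ω : Config T) (m : ℕ) :
    {v | Descends ω v ∧ v.length = m}.Finite := by
  induction m with
  | zero =>
    refine (Set.finite_singleton []).subset fun v hv => ?_
    exact List.length_eq_zero_iff.1 hv.2
  | succ m ih =>
    refine (ih.biUnion fun v _ => Set.finite_iUnion fun j : T =>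
      (Set.finite_Iio ((ω v).1 j)).image fun i => (j, i) :: v).subset ?_
    rintro (_ | ⟨c, v⟩) ⟨h, hlen⟩
    · simp at hlen
    · refine Set.mem_biUnion (x := v) ⟨h.1, by simpa using hlen⟩ ?_
      exact Set.mem_iUnion.2 ⟨c.1, c.2, h.2.1, rfl⟩

theorem past_finite [Finite T] {ω : Config T} {k : ℕ} (hω : ω ∈ pastDepthLT T k) :
    (past (branchingTree fun v => (ω v).1) (fun v => (ω v).2) []).Finite := by
  rw [past_eq]
  refine ((Set.finite_Iio k).biUnion fun m _ => finite_descends_length ω m).subset fun v hv => ?_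
  exact Set.mem_biUnion (x := v.length) (Descends.length_lt hω hv).1 ⟨hv, rfl⟩

theorem rootOccupied_iff [Finite T] {ω : Config T} {k : ℕ} (hω : ω ∈ pastDepthLT T k)
    (hinj : Function.Injective fun v => (ω v).2) :
    RootOccupied (branchingTree fun v => (ω v).1) (fun v => (ω v).2) [] ↔
      ω ∈ occupiedUpTo T k := by
  have key : ∀ l, IsArrivalOrder (fun v => (ω v).2)
      (past (branchingTree fun v => (ω v).1) (fun v => (ω v).2) []) l →
      ([] ∈ greedySet (branchingTree fun v => (ω v).1) l ↔ ω ∈ occupiedUpTo T k) := by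
    rintro l ⟨hl, hmem⟩
    simp only [past_eq, Set.mem_ofPred_eq] at hmem
    rw [greedySet_eq_of_recursion (P := fun v => subtree v ω ∈ occupiedUpTo T k) hl]
    · have h1 : ([] : Node T) ∈ l := (hmem []).2 trivial
      simp [h1, subtree_nil]
    · intro v hv
      have hd := (hmem v).1 hv
      have hdep := pastDepthLT_mono (Nat.sub_le _ _) (Descends.length_lt hω hd).2
      rw [← occupiedUpTo_succ_iff hdep]
      refine subtree_mem_rootFree.trans ⟨fun h u hu hlt hadj => ?_, fun h c h1 h2 => ?_⟩
      · rcases branchingTree_adj.1 hadj with ⟨-, c, rfl⟩ | ⟨-, c, rfl⟩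
        · exact absurd hlt hd.2.2.not_gt
        · exact h c ((hmem _).1 hu).2.1 hlt
      · have hd' : Descends ω (c :: v) := ⟨hd, h1, h2⟩
        exact h _ ((hmem _).2 hd') h2 (branchingTree_adj.2 (Or.inr ⟨hd'.inTree, c, rfl⟩))
  constructor
  · rintro ⟨l, hl, h⟩
    exact (key l hl).1 h
  · intro h
    obtain ⟨l, hl⟩ := exists_isArrivalOrder hinj (past_finite hω)
    exact ⟨l, hl, (key l hl).2 h⟩

end Deterministic

theorem prod_infinitePi_map_zip {ι X Y : Type*} [MeasurableSpace X] [MeasurableSpace Y]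
    (μ : ι → Measure X) (ν : ι → Measure Y) [∀ i, IsProbabilityMeasure (μ i)]
    [∀ i, IsProbabilityMeasure (ν i)] :
    ((Measure.infinitePi μ).prod (Measure.infinitePi ν)).map
      (fun p i => (p.1 i, p.2 i)) = Measure.infinitePi fun i => (μ i).prod (ν i) := by
  refine ((Measure.isProjectiveLimit_infinitePi fun i => (μ i).prod (ν i)).unique ?_).symm
  intro s
  rw [Measure.map_map (by fun_prop) (by fun_prop)]
  have h := (measurePreserving_arrowProdEquivProdArrow X Y s (fun i => μ i) (fun i => ν i)).symm
  beta_reduce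
  rw [← h.map_eq, ← Measure.infinitePi_map_restrict, ← Measure.infinitePi_map_restrict,
    Measure.map_prod_map _ _ (by fun_prop) (by fun_prop),
    Measure.map_map (by fun_prop) (by fun_prop)]
  rfl

theorem lintegral_infinitePi_prod {ι : Type*} [Fintype ι] {X : ι → Type*}
    [∀ i, MeasurableSpace (X i)] (μ : ∀ i, Measure (X i)) [∀ i, IsProbabilityMeasure (μ i)]
    (f : ∀ i, X i → ℝ≥0∞) (hf : ∀ i, Measurable (f i)) :
    ∫⁻ x, ∏ i, f i (x i) ∂(Measure.infinitePi μ) = ∏ i, ∫⁻ y, f i y ∂(μ i) := by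
  rw [lintegral_prod_eq_prod_lintegral_of_indepFun _ (fun i (x : ∀ i, X i) => f i (x i))
    (iIndepFun_infinitePi hf) fun i => (hf i).comp (measurable_pi_apply i)]
  refine Finset.prod_congr rfl fun i _ => ?_
  rw [← Measure.infinitePi_map_eval μ i, lintegral_map (hf i) (measurable_pi_apply i)]

section Law

variable {T : Type*} (τ : T) (μ : T → T → Measure ℕ)

/-- The law of the offspring numbers and the label of a vertex of type `τ`. -/
noncomputable def vertexLaw : Measure ((T → ℕ) × unitInterval) :=
  (Measure.infinitePi fun j => μ τ j).prod volume

/-- The law of the offspring numbers and labels of all vertices. -/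
noncomputable def configLaw : Measure (Config T) :=
  Measure.infinitePi fun v => vertexLaw (nodeType τ v) μ

variable [∀ k j, IsProbabilityMeasure (μ k j)]

instance : IsProbabilityMeasure (vertexLaw τ μ) := by
  unfold vertexLaw; infer_instance

instance : IsProbabilityMeasure (configLaw τ μ) := by
  unfold configLaw; infer_instance

instance : IsProbabilityMeasure (offspringLaw τ μ) := by
  unfold offspringLaw; infer_instance

instance (V : Type*) : IsProbabilityMeasure (labelLaw V) := by
  unfold labelLaw; infer_instance

theorem offspringLaw_prod_labelLaw_map :
    ((offspringLaw τ μ).prod (labelLaw (Node T))).map (fun p v => (p.1 v, p.2 v)) =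
      configLaw τ μ :=
  prod_infinitePi_map_zip (fun v => Measure.infinitePi fun j => μ (nodeType τ v) j)
    (fun _ => volume)

/-- The configuration with root data `p.1` and subtrees `p.2`. -/
def glue (p : ((T → ℕ) × unitInterval) × ((T × ℕ) × Node T → (T → ℕ) × unitInterval)) :
    Config T :=
  fun v => if h : v = [] then p.1 else p.2 (v.getLast h, v.dropLast)

theorem glue_nil (p : ((T → ℕ) × unitInterval) × ((T × ℕ) × Node T → (T → ℕ) × unitInterval)) :
    glue p [] = p.1 := rfl

theorem glue_concat
    (p : ((T → ℕ) × unitInterval) × ((T × ℕ) × Node T → (T → ℕ) × unitInterval))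
    (c : T × ℕ) (u : Node T) : glue p (u ++ [c]) = p.2 (c, u) := by
  simp [glue]

theorem measurable_glue : Measurable (glue (T := T)) := by
  refine measurable_pi_lambda _ fun v => ?_
  by_cases h : v = []
  · simp only [glue, dif_pos h]; fun_prop
  · simp only [glue, dif_neg h]; fun_prop

theorem nodeType_concat (c : T × ℕ) (u : Node T) : nodeType τ (u ++ [c]) = nodeType c.1 u := by
  cases u <;> rfl

theorem map_glue :
    ((vertexLaw τ μ).prod
      (Measure.infinitePi fun q : (T × ℕ) × Node T => vertexLaw (nodeType q.1.1 q.2) μ)).map glue =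
      configLaw τ μ := by
  classical
  refine Measure.eq_infinitePi _ fun s t ht => ?_
  have hinj : Function.Injective fun q : (T × ℕ) × Node T => q.2 ++ [q.1] := by
    rintro ⟨c, u⟩ ⟨c', u'⟩ h
    obtain ⟨h1, h2⟩ := List.append_inj' h rfl
    simp_all
  set s' : Finset ((T × ℕ) × Node T) := s.preimage _ hinj.injOn
  have hpre : glue ⁻¹' ((s : Set (Node T)).pi t) =
      (if [] ∈ s then t [] else Set.univ) ×ˢ
        ((s' : Set ((T × ℕ) × Node T)).pi fun q => t (q.2 ++ [q.1])) := by
    ext p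
    simp only [Set.mem_preimage, Set.mem_pi, Finset.mem_coe, Set.mem_prod, s',
      Finset.mem_preimage]
    constructor
    · intro h
      refine ⟨?_, fun q hq => ?_⟩
      · split_ifs with h0
        · exact h [] h0
        · trivial
      · have := h _ hq
        rwa [glue_concat] at this
    · rintro ⟨h1, h2⟩ v hv
      rcases List.eq_nil_or_concat' v with rfl | ⟨u, c, rfl⟩
      · rw [if_pos hv] at h1; exact h1
      · rw [glue_concat]; exact h2 (c, u) hv
  rw [Measure.map_apply measurable_glue (.pi s.countable_toSet fun _ _ => ht _), hpre,
    Measure.prod_prod, Measure.infinitePi_pi _ fun _ _ => ht _]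
  have h1 : ∏ q ∈ s', vertexLaw (nodeType q.1.1 q.2) μ (t (q.2 ++ [q.1])) =
      ∏ v ∈ s.erase [], vertexLaw (nodeType τ v) μ (t v) := by
    have hs' : s' = (s.erase []).preimage _ hinj.injOn := by
      ext q; simp [s']
    rw [hs', ← Finset.prod_preimage (fun q : (T × ℕ) × Node T => q.2 ++ [q.1]) (s.erase [])
      hinj.injOn (fun v => vertexLaw (nodeType τ v) μ (t v))]
    · exact Finset.prod_congr rfl fun q _ => by rw [nodeType_concat]
    · intro v hv hv'
      rcases List.eq_nil_or_concat' v with rfl | ⟨u, c, rfl⟩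
      · simp at hv
      · exact absurd ⟨(c, u), rfl⟩ hv'
  rw [h1]
  split_ifs with h0
  · rw [← Finset.mul_prod_erase s _ h0]; rfl
  · rw [measure_univ, one_mul, Finset.erase_eq_of_notMem h0]

theorem map_glue_curry :
    ((vertexLaw τ μ).prod (Measure.infinitePi fun c : T × ℕ => configLaw c.1 μ)).map
      (fun p => glue (p.1, fun q => p.2 q.1 q.2)) = configLaw τ μ := by
  have h := Measure.infinitePi_map_curry_symm
    (fun (c : T × ℕ) (v : Node T) => vertexLaw (nodeType c.1 v) μ)
  rw [← map_glue, ← h, ← Measure.map_id (μ := vertexLaw τ μ),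
    Measure.map_prod_map _ _ (by fun_prop) (by fun_prop),
    Measure.map_map measurable_glue (by fun_prop), Measure.map_id]
  rfl

theorem measurableSet_rootFree [Countable T] {A : Set (Config T)} (hA : MeasurableSet A) :
    MeasurableSet (rootFree A) := by
  have : rootFree A = ⋂ c : T × ℕ, ({ω : Config T | c.2 < (ω []).1 c.1} ∩
      {ω | (ω [c]).2 < (ω []).2} ∩ subtree [c] ⁻¹' A)ᶜ := by
    ext ω
    simp only [Set.mem_iInter, Set.mem_compl_iff, Set.mem_inter_iff, Set.mem_preimage,
      Set.mem_ofPred_eq, not_and, and_imp]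
    rfl
  rw [this]
  refine MeasurableSet.iInter fun c => (((?_ : MeasurableSet _).inter ?_).inter ?_).compl
  · exact measurableSet_lt measurable_const (by fun_prop)
  · exact measurableSet_lt (by fun_prop) (by fun_prop)
  · exact hA.preimage (measurable_pi_lambda _ fun v => measurable_pi_apply _)

theorem measurableSet_occupiedUpTo [Countable T] (k : ℕ) : MeasurableSet (occupiedUpTo T k) := by
  induction k with
  | zero => exact MeasurableSet.empty
  | succ k ih => exact measurableSet_rootFree ih

theorem measurableSet_pastDepthLT [Countable T] (k : ℕ) : MeasurableSet (pastDepthLT T k) := by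
  induction k with
  | zero => exact MeasurableSet.empty
  | succ k ih => exact measurableSet_rootFree ih.compl

/-- The configurations in `A` whose root has a label below `y`. -/
def lowRoot (A : Set (Config T)) (y : unitInterval) : Set (Config T) :=
  {ω | (ω []).2 < y ∧ ω ∈ A}

theorem measurableSet_lowRoot {A : Set (Config T)} (hA : MeasurableSet A) (y : unitInterval) :
    MeasurableSet (lowRoot A y) :=
  (measurableSet_lt (by fun_prop) measurable_const).inter hA

theorem measurable_configLaw_lowRoot_compl {A : Set (Config T)} (hA : MeasurableSet A) :
    Measurable fun y => configLaw τ μ (lowRoot A y)ᶜ := by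
  have : MeasurableSet {p : unitInterval × Config T | p.2 ∈ (lowRoot A p.1)ᶜ} := by
    refine MeasurableSet.compl (MeasurableSet.inter ?_ (hA.preimage measurable_snd))
    exact measurableSet_lt (by fun_prop) (by fun_prop)
  exact measurable_measure_prodMk_left this

theorem configLaw_rootFree [Fintype T] {A : Set (Config T)} (hA : MeasurableSet A)
    {B : Set unitInterval} (hB : MeasurableSet B) :
    configLaw τ μ {ω | (ω []).2 ∈ B ∧ ω ∈ rootFree A} =
      ∫⁻ y in B, ∏ j, ∫⁻ m, (configLaw j μ (lowRoot A y)ᶜ) ^ m ∂(μ τ j) := by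
  classical
  have hms : MeasurableSet {ω : Config T | (ω []).2 ∈ B ∧ ω ∈ rootFree A} :=
    (hB.preimage (by fun_prop)).inter (measurableSet_rootFree hA)
  have hg : Measurable fun p : ((T → ℕ) × unitInterval) × (T × ℕ → Config T) =>
      glue (p.1, fun q => p.2 q.1 q.2) := measurable_glue.comp (by fun_prop)
  rw [← map_glue_curry, Measure.map_apply hg hms, Measure.prod_apply (hg hms)]
  have hq : ∀ j : T, Measurable fun y => configLaw j μ (lowRoot A y)ᶜ := fun j =>
    measurable_configLaw_lowRoot_compl j μ hA
  have hinner : ∀ x : (T → ℕ) × unitInterval,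
      Measure.infinitePi (fun c : T × ℕ => configLaw c.1 μ) (Prod.mk x ⁻¹'
        ((fun p : ((T → ℕ) × unitInterval) × (T × ℕ → Config T) =>
          glue (p.1, fun q => p.2 q.1 q.2)) ⁻¹' {ω | (ω []).2 ∈ B ∧ ω ∈ rootFree A})) =
      B.indicator (fun y => ∏ j, (configLaw j μ (lowRoot A y)ᶜ) ^ (x.1 j)) x.2 := by
    rintro ⟨m, y⟩
    by_cases hy : y ∈ B
    · rw [Set.indicator_of_mem hy]
      let S : Finset (T × ℕ) := (Finset.univ.sigma fun j => Finset.range (m j)).map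
        (Equiv.sigmaEquivProd T ℕ).toEmbedding
      have hS : ∀ c : T × ℕ, c ∈ S ↔ c.2 < m c.1 := by
        rintro ⟨j, i⟩
        simp [S]
      have hset : (Prod.mk (m, y) ⁻¹' ((fun p : ((T → ℕ) × unitInterval) × (T × ℕ → Config T) =>
          glue (p.1, fun q => p.2 q.1 q.2)) ⁻¹' {ω | (ω []).2 ∈ B ∧ ω ∈ rootFree A})) =
          (S : Set (T × ℕ)).pi fun c => (lowRoot A y)ᶜ := by
        ext η
        have hsub : ∀ c : T × ℕ, subtree [c] (glue ((m, y), fun q => η q.1 q.2)) = η c := by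
          intro c
          funext u
          exact glue_concat _ c u
        have hroot : ∀ c : T × ℕ, glue ((m, y), fun q => η q.1 q.2) [c] = η c [] := fun c =>
          glue_concat _ c []
        simp only [Set.mem_preimage, Set.mem_ofPred_eq, rootFree, glue_nil, hy, true_and, hsub,
          hroot, Set.mem_pi, Finset.mem_coe, hS, lowRoot, Set.mem_compl_iff, not_and]
      rw [hset, Measure.infinitePi_pi _ fun c _ => (measurableSet_lowRoot hA y).compl]
      simp only [S, Finset.prod_map, Finset.prod_sigma]
      simp
    · rw [Set.indicator_of_notMem hy]
      have hempty : (Prod.mk (m, y) ⁻¹' ((fun p : ((T → ℕ) × unitInterval) × (T × ℕ → Config T) =>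
          glue (p.1, fun q => p.2 q.1 q.2)) ⁻¹' {ω | (ω []).2 ∈ B ∧ ω ∈ rootFree A})) = ∅ := by
        ext η
        simp [glue_nil, hy]
      rw [hempty, measure_empty]
  simp_rw [hinner]
  rw [vertexLaw, lintegral_prod_symm]
  · rw [← lintegral_indicator hB]
    refine lintegral_congr fun y => ?_
    by_cases hy : y ∈ B
    · simp only [Set.indicator_of_mem hy]
      exact lintegral_infinitePi_prod _ (fun j m => (configLaw j μ (lowRoot A y)ᶜ) ^ m)
        fun j => .of_discrete
    · simp [Set.indicator_of_notMem hy]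
  · refine Measurable.aemeasurable ?_
    change Measurable (Set.indicator (Prod.snd ⁻¹' B) fun z : (T → ℕ) × unitInterval =>
      ∏ j, (configLaw j μ (lowRoot A z.2)ᶜ) ^ (z.1 j))
    refine Measurable.indicator ?_ (hB.preimage measurable_snd)
    refine Finset.measurable_prod _ fun j _ => Measurable.pow ?_ (by fun_prop)
    exact (hq j).comp measurable_snd

theorem ae_injective_labels [Countable T] :
    ∀ᵐ ω ∂(configLaw τ μ), Function.Injective fun v => (ω v).2 := by
  have h : ∀ u v : Node T, u ≠ v → ∀ᵐ ω ∂(configLaw τ μ), (ω u).2 ≠ (ω v).2 := by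
    intro u v huv
    have hm := Measure.infinitePi_map_eval_prod (P := fun v => vertexLaw (nodeType τ v) μ) huv
    have hd : MeasurableSet {p : ((T → ℕ) × unitInterval) × ((T → ℕ) × unitInterval) |
        p.1.2 = p.2.2} := measurableSet_eq_fun (by fun_prop) (by fun_prop)
    rw [ae_iff]
    simp only [ne_eq, not_not]
    have hz : ((vertexLaw (nodeType τ u) μ).prod (vertexLaw (nodeType τ v) μ))
        {p | p.1.2 = p.2.2} = 0 := by
      rw [Measure.measure_prod_null hd]
      refine Eventually.of_forall fun x => ?_
      beta_reduce
      have : Prod.mk x ⁻¹' {p : ((T → ℕ) × unitInterval) × ((T → ℕ) × unitInterval) |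
          p.1.2 = p.2.2} = Set.univ ×ˢ {x.2} := by
        ext y; simp [eq_comm]
      rw [this, vertexLaw, Measure.prod_prod]
      simp
    rw [← hm, Measure.map_apply (by fun_prop) hd] at hz
    exact hz
  have h' : ∀ᵐ ω ∂(configLaw τ μ), ∀ u v : Node T, u ≠ v → (ω u).2 ≠ (ω v).2 :=
    ae_all_iff.2 fun u => ae_all_iff.2 fun v => by
      by_cases huv : u = v
      · simp [huv]
      · filter_upwards [h u v huv] with ω hω _ using hω
  filter_upwards [h'] with ω hω u v huv
  by_contra hne
  exact hω u v hne huv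

end Law

section Recursion

variable {T : Type*} (μ : T → T → Measure ℕ)

/-- The probability of `A` and of the root label being below `y`, for the root type `τ`. -/
noncomputable def lowProb (A : Set (Config T)) (τ : T) (y : unitInterval) : ℝ :=
  (configLaw τ μ).real (lowRoot A y)

theorem lowProb_nonneg (A : Set (Config T)) (τ : T) (y : unitInterval) : 0 ≤ lowProb μ A τ y :=
  measureReal_nonneg

theorem lowProb_mem_Icc [∀ k j, IsProbabilityMeasure (μ k j)] (A : Set (Config T)) (τ : T)
    (y : unitInterval) : lowProb μ A τ y ∈ Set.Icc (0 : ℝ) 1 :=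
  ⟨measureReal_nonneg, measureReal_le_one⟩

theorem measurable_zip : Measurable fun (p : (Node T → T → ℕ) × (Node T → unitInterval)) =>
    (fun v => (p.1 v, p.2 v) : Config T) := by
  fun_prop

theorem ae_zip {μ : T → T → Measure ℕ} [∀ k j, IsProbabilityMeasure (μ k j)]
    {P : Config T → Prop} {τ : T} (h : ∀ᵐ ω ∂(configLaw τ μ), P ω) :
    ∀ᵐ p ∂((offspringLaw τ μ).prod (labelLaw (Node T))), P fun v => (p.1 v, p.2 v) := by
  rw [← offspringLaw_prod_labelLaw_map] at h
  exact ae_of_ae_map measurable_zip.aemeasurable h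

variable [Fintype T]

/-- The probability that a vertex of type `τ` has no marked child, when its children of type `j`
are marked independently with probability `s j`. -/
noncomputable def unmarkedProb (τ : T) (s : T → ℝ) : ℝ :=
  ∏ j, ∫ m, (1 - s j) ^ m ∂(μ τ j)

/-- The solution of the limiting recursion. -/
structure IsFluidLimit (F : T → ℝ → ℝ) : Prop where
  continuousOn : ∀ τ, ContinuousOn (fun t => unmarkedProb μ τ fun j => F j t) (Set.Icc 0 1)
  mem_Icc : ∀ τ, ∀ t ∈ Set.Icc (0 : ℝ) 1, F τ t ∈ Set.Icc (0 : ℝ) t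
  eq_integral : ∀ τ, ∀ t ∈ Set.Icc (0 : ℝ) 1,
    F τ t = ∫ s in (0 : ℝ)..t, unmarkedProb μ τ fun j => F j s

theorem integrableOn_fluidLimit {μ : T → T → Measure ℕ} {F : T → ℝ → ℝ} (hF : IsFluidLimit μ F)
    (τ : T) (B : Set unitInterval) :
    IntegrableOn (fun y : unitInterval => unmarkedProb μ τ fun j => F j y) B := by
  refine Integrable.integrableOn (Continuous.integrable_of_hasCompactSupport ?_
    (HasCompactSupport.of_compactSpace _))
  exact (hF.continuousOn τ).comp_continuous continuous_subtype_val fun y => y.2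

theorem IsFluidLimit.mem_unit {μ : T → T → Measure ℕ} {F : T → ℝ → ℝ} (hF : IsFluidLimit μ F)
    (τ : T) (y : unitInterval) :
    F τ y ∈ Set.Icc (0 : ℝ) 1 :=
  ⟨(hF.mem_Icc τ y y.2).1, (hF.mem_Icc τ y y.2).2.trans y.2.2⟩

variable [∀ k j, IsProbabilityMeasure (μ k j)]

theorem prod_lintegral_pow_le_one {A : Set (Config T)} (τ : T) (y : unitInterval) :
    ∏ j, ∫⁻ m, (configLaw j μ (lowRoot A y)ᶜ) ^ m ∂(μ τ j) ≤ 1 := by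
  refine Finset.prod_le_one' fun j _ => ?_
  calc ∫⁻ m, (configLaw j μ (lowRoot A y)ᶜ) ^ m ∂(μ τ j) ≤ ∫⁻ _, 1 ∂(μ τ j) :=
        lintegral_mono fun m => pow_le_one' prob_le_one m
    _ = 1 := by simp

theorem toReal_prod_lintegral_pow {A : Set (Config T)} (hA : MeasurableSet A) (τ : T)
    (y : unitInterval) :
    (∏ j, ∫⁻ m, (configLaw j μ (lowRoot A y)ᶜ) ^ m ∂(μ τ j)).toReal =
      unmarkedProb μ τ fun j => lowProb μ A j y := by
  rw [ENNReal.toReal_prod, unmarkedProb]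
  refine Finset.prod_congr rfl fun j _ => ?_
  rw [← integral_toReal]
  · refine integral_congr_ae (Eventually.of_forall fun m => ?_)
    beta_reduce
    rw [ENNReal.toReal_pow, lowProb, ← probReal_compl_eq_one_sub (measurableSet_lowRoot hA y)]
    rfl
  · exact Measurable.aemeasurable .of_discrete
  · exact Eventually.of_forall fun m => ENNReal.pow_lt_top (measure_lt_top _ _)

theorem measurable_prod_lintegral_pow {A : Set (Config T)} (hA : MeasurableSet A) (τ : T) :
    Measurable fun y => ∏ j, ∫⁻ m, (configLaw j μ (lowRoot A y)ᶜ) ^ m ∂(μ τ j) := by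
  refine Finset.measurable_prod _ fun j _ => Measurable.lintegral_prod_right ?_
  refine Measurable.pow ?_ measurable_snd
  exact (measurable_configLaw_lowRoot_compl j μ hA).comp measurable_fst

theorem integrable_unmarkedProb {A : Set (Config T)} (hA : MeasurableSet A) (τ : T)
    (B : Set unitInterval) :
    IntegrableOn (fun y => unmarkedProb μ τ fun j => lowProb μ A j y) B := by
  simp_rw [← toReal_prod_lintegral_pow μ hA]
  refine Integrable.integrableOn (Integrable.of_bound
    (measurable_prod_lintegral_pow μ hA τ).ennreal_toReal.aestronglyMeasurable 1
    (Eventually.of_forall fun y => ?_))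
  rw [Real.norm_of_nonneg ENNReal.toReal_nonneg]
  exact ENNReal.toReal_mono ENNReal.one_ne_top (prod_lintegral_pow_le_one μ τ y)

theorem configLaw_real_rootFree {A : Set (Config T)} (hA : MeasurableSet A) (τ : T)
    {B : Set unitInterval} (hB : MeasurableSet B) :
    (configLaw τ μ).real {ω | (ω []).2 ∈ B ∧ ω ∈ rootFree A} =
      ∫ y in B, unmarkedProb μ τ fun j => lowProb μ A j y := by
  rw [Measure.real, configLaw_rootFree τ μ hA hB]
  simp_rw [← toReal_prod_lintegral_pow μ hA]
  rw [integral_toReal (measurable_prod_lintegral_pow μ hA τ).aemeasurable]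
  exact Eventually.of_forall fun y =>
    (prod_lintegral_pow_le_one μ τ y).trans_lt ENNReal.one_lt_top

theorem setIntegral_Iio_unitInterval (φ : ℝ → ℝ) (x : unitInterval) :
    ∫ y in Set.Iio x, φ y = ∫ t in (0 : ℝ)..x, φ t := by
  have h := unitInterval.measurePreserving_coe.setIntegral_preimage_emb
    unitInterval.measurableEmbedding_coe φ (Set.Iio (x : ℝ))
  have hpre : ((↑) : unitInterval → ℝ) ⁻¹' Set.Iio (x : ℝ) = Set.Iio x := by
    ext y; simp
  rw [hpre] at h
  rw [h, Measure.restrict_restrict measurableSet_Iio, intervalIntegral.integral_of_le x.2.1,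
    integral_Ioc_eq_integral_Ioo, ← integral_Ico_eq_integral_Ioo]
  congr 2
  ext t
  simp only [Set.mem_inter_iff, Set.mem_Iio, Set.mem_Icc, Set.mem_Ico, unitInterval]
  exact ⟨fun h => ⟨h.2.1, h.1⟩, fun h => ⟨h.2, h.1, h.2.le.trans x.2.2⟩⟩

theorem setIntegral_univ_unitInterval (φ : ℝ → ℝ) :
    ∫ y : unitInterval in Set.univ, φ y = ∫ t in (0 : ℝ)..1, φ t := by
  rw [← Set.Iic_top, integral_Iic_eq_integral_Iio]
  exact setIntegral_Iio_unitInterval φ 1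

theorem setIntegral_pow_Iio (x : unitInterval) (k : ℕ) (C : ℝ) :
    ∫ y in Set.Iio x, C * (y : ℝ) ^ k / (k.factorial : ℝ) =
      C * (x : ℝ) ^ (k + 1) / ((k + 1).factorial : ℝ) := by
  rw [setIntegral_Iio_unitInterval fun t => C * t ^ k / (k.factorial : ℝ)]
  rw [intervalIntegral.integral_div, intervalIntegral.integral_const_mul, integral_pow,
    Nat.factorial_succ]
  push_cast
  field_simp
  simp

/-- The Lipschitz bound that makes the Picard iteration converge. -/
def IsLipschitzUnmarked (M : ℝ) : Prop :=
  ∀ τ : T, ∀ s s' : T → ℝ, (∀ j, s j ∈ Set.Icc (0 : ℝ) 1) → (∀ j, s' j ∈ Set.Icc (0 : ℝ) 1) →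
    ∀ δ : ℝ, (∀ j, |s j - s' j| ≤ δ) → |unmarkedProb μ τ s - unmarkedProb μ τ s'| ≤ M * δ

variable {μ}

/-- One Picard step. -/
theorem abs_integral_sub_le {M : ℝ} (hM : IsLipschitzUnmarked μ M) {A : Set (Config T)}
    (hA : MeasurableSet A) (τ : T) {G : T → unitInterval → ℝ}
    (hG : ∀ j y, G j y ∈ Set.Icc (0 : ℝ) 1) {B : Set unitInterval}
    (hGint : IntegrableOn (fun y => unmarkedProb μ τ fun j => G j y) B)
    {k : ℕ} {C : ℝ} (hle : ∀ j y, |lowProb μ A j y - G j y| ≤ C * (y : ℝ) ^ k / (k.factorial : ℝ)) :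
    |(∫ y in B, unmarkedProb μ τ fun j => lowProb μ A j y) -
      ∫ y in B, unmarkedProb μ τ fun j => G j y| ≤
      ∫ y in B, M * C * (y : ℝ) ^ k / (k.factorial : ℝ) := by
  rw [← integral_sub (integrable_unmarkedProb μ hA τ B) hGint]
  refine (abs_integral_le_integral_abs).trans ?_
  refine integral_mono_of_nonneg (Eventually.of_forall fun y => abs_nonneg _) ?_
    (Eventually.of_forall fun y => ?_)
  · refine Integrable.integrableOn (Continuous.integrable_of_hasCompactSupport (by fun_prop) ?_)
    exact HasCompactSupport.of_compactSpace _
  · have := hM τ _ _ (fun j => lowProb_mem_Icc μ A j y) (fun j => hG j y) _ (fun j => hle j y)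
    calc _ ≤ _ := this
      _ = _ := by ring

theorem lowProb_rootFree {A : Set (Config T)} (hA : MeasurableSet A) (τ : T) (x : unitInterval) :
    lowProb μ (rootFree A) τ x = ∫ y in Set.Iio x, unmarkedProb μ τ fun j => lowProb μ A j y :=
  configLaw_real_rootFree μ hA τ measurableSet_Iio

theorem abs_lowProb_occupied_sub_le {M : ℝ} (hM : IsLipschitzUnmarked μ M) {F : T → ℝ → ℝ}
    (hF : IsFluidLimit μ F) (k : ℕ) (τ : T) (x : unitInterval) :
    |lowProb μ (occupiedUpTo T k) τ x - F τ x| ≤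
      M ^ k * (x : ℝ) ^ (k + 1) / ((k + 1).factorial : ℝ) := by
  induction k generalizing τ x with
  | zero =>
    have h := hF.mem_Icc τ x x.2
    have h0 : lowProb μ (occupiedUpTo T 0) τ x = 0 := by
      simp [lowProb, lowRoot, occupiedUpTo]
    rw [h0, zero_sub, abs_neg, abs_of_nonneg h.1]
    simpa using h.2
  | succ k ih =>
    rw [occupiedUpTo, lowProb_rootFree (measurableSet_occupiedUpTo k), hF.eq_integral τ x x.2,
      ← setIntegral_Iio_unitInterval]
    refine (abs_integral_sub_le hM (measurableSet_occupiedUpTo k) τ (fun j y => hF.mem_unit j y)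
      (integrableOn_fluidLimit hF τ _) ih).trans ?_
    rw [setIntegral_pow_Iio, ← pow_succ' M]

theorem unmarkedProb_zero (τ : T) : unmarkedProb μ τ (fun _ => 0) = 1 := by
  simp [unmarkedProb]

theorem configLaw_real_root (τ : T) {B : Set unitInterval} (hB : MeasurableSet B) :
    (configLaw τ μ).real {ω | (ω []).2 ∈ B} = ∫ _y in B, unmarkedProb μ τ fun _ => 0 := by
  have h := configLaw_real_rootFree μ (A := ∅) MeasurableSet.empty τ hB
  have h1 : {ω : Config T | (ω []).2 ∈ B ∧ ω ∈ rootFree ∅} = {ω | (ω []).2 ∈ B} := by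
    ext ω; simp [rootFree]
  have h2 : ∀ j y, lowProb μ (∅ : Set (Config T)) j y = 0 := by
    intro j y; simp [lowProb, lowRoot]
  rw [h1] at h
  simpa only [h2] using h

theorem configLaw_real_compl_rootFree {A : Set (Config T)} (hA : MeasurableSet A) (τ : T)
    {B : Set unitInterval} (hB : MeasurableSet B) :
    (configLaw τ μ).real {ω | (ω []).2 ∈ B ∧ ω ∈ (rootFree A)ᶜ} =
      (∫ _y in B, unmarkedProb μ τ fun _ => 0) -
        ∫ y in B, unmarkedProb μ τ fun j => lowProb μ A j y := by
  rw [← configLaw_real_root τ hB, ← configLaw_real_rootFree μ hA τ hB]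
  have := measureReal_sdiff_add_inter (μ := configLaw τ μ) (s := {ω : Config T | (ω []).2 ∈ B})
    (measurableSet_rootFree hA)
  rw [← this]
  exact (add_sub_cancel_right _ _).symm

theorem lowProb_deep_le {M : ℝ} (hM : IsLipschitzUnmarked μ M) (k : ℕ) (τ : T)
    (x : unitInterval) :
    lowProb μ (pastDepthLT T k)ᶜ τ x ≤
      M ^ k * (x : ℝ) ^ (k + 1) / ((k + 1).factorial : ℝ) := by
  induction k generalizing τ x with
  | zero =>
    have h : lowRoot (pastDepthLT T 0)ᶜ x = {ω : Config T | (ω []).2 ∈ Set.Iio x} := by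
      ext ω; simp [lowRoot, pastDepthLT]
    rw [lowProb, h, configLaw_real_root τ measurableSet_Iio]
    simp_rw [unmarkedProb_zero]
    have := setIntegral_pow_Iio x 0 1
    simp only [pow_zero, Nat.factorial_zero, Nat.cast_one, mul_one, div_one] at this
    rw [this]
    simp
  | succ k ih =>
    have h := configLaw_real_compl_rootFree (μ := μ) (measurableSet_pastDepthLT k).compl τ
      (measurableSet_Iio (a := x))
    have hle := abs_integral_sub_le hM (measurableSet_pastDepthLT k).compl τ
      (G := fun _ _ => 0) (fun _ _ => by simp) (B := Set.Iio x) (by simp [unmarkedProb_zero])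
      (k := k + 1) (C := M ^ k) (fun j y => by
        rw [sub_zero, abs_of_nonneg (lowProb_nonneg μ _ j y)]; exact ih j y)
    rw [setIntegral_pow_Iio, abs_sub_comm, ← pow_succ'] at hle
    exact h.le.trans ((le_abs_self _).trans hle)

theorem abs_prob_occupied_sub_le {M : ℝ} (hM : IsLipschitzUnmarked μ M) {F : T → ℝ → ℝ}
    (hF : IsFluidLimit μ F) (k : ℕ) (τ : T) :
    |(configLaw τ μ).real (occupiedUpTo T (k + 1)) - F τ 1| ≤
      M ^ (k + 1) / ((k + 2).factorial : ℝ) := by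
  have h := configLaw_real_rootFree μ (measurableSet_occupiedUpTo (T := T) k) τ MeasurableSet.univ
  simp only [Set.mem_univ, true_and] at h
  have h1 := setIntegral_univ_unitInterval fun t => unmarkedProb μ τ fun j => F j t
  rw [← hF.eq_integral τ 1 (by simp)] at h1
  have h2 := abs_integral_sub_le hM (measurableSet_occupiedUpTo k) τ (fun j y => hF.mem_unit j y)
      (integrableOn_fluidLimit hF τ Set.univ) (abs_lowProb_occupied_sub_le hM hF k)
  rw [← h, h1, ← Set.Iic_top, integral_Iic_eq_integral_Iio] at h2
  have h3 := setIntegral_pow_Iio 1 (k + 1) (M * M ^ k)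
  refine h2.trans (h3.le.trans ?_)
  simp [pow_succ']

theorem prob_deep_le {M : ℝ} (hM : IsLipschitzUnmarked μ M) (k : ℕ) (τ : T) :
    (configLaw τ μ).real (pastDepthLT T (k + 1))ᶜ ≤ M ^ (k + 1) / ((k + 2).factorial : ℝ) := by
  have h := configLaw_real_compl_rootFree (μ := μ) (measurableSet_pastDepthLT (T := T) k).compl τ
    MeasurableSet.univ
  simp only [Set.mem_univ, true_and] at h
  have hle := abs_integral_sub_le hM (measurableSet_pastDepthLT k).compl τ
      (G := fun _ _ => 0) (fun _ _ => by simp) (B := Set.univ) (by simp [unmarkedProb_zero])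
      (k := k + 1) (C := M ^ k) (fun j y => by
        rw [sub_zero, abs_of_nonneg (lowProb_nonneg μ _ j y)]; exact lowProb_deep_le hM k j y)
  rw [abs_sub_comm] at hle
  have h3 := setIntegral_pow_Iio 1 (k + 1) (M * M ^ k)
  rw [← integral_Iic_eq_integral_Iio] at h3
  change ∫ y in Set.Iic ⊤, _ = _ at h3
  rw [Set.Iic_top] at h3
  refine (h.le.trans ((le_abs_self _).trans hle)).trans (h3.le.trans ?_)
  simp [pow_succ']

theorem tendsto_pow_div_factorial (M : ℝ) :
    Tendsto (fun k : ℕ => M ^ (k + 1) / ((k + 2).factorial : ℝ)) atTop (𝓝 0) := by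
  refine squeeze_zero_norm (fun k => ?_)
    ((FloorSemiring.tendsto_pow_div_factorial_atTop |M|).comp (tendsto_add_atTop_nat 1))
  rw [norm_div, norm_pow, Real.norm_eq_abs, Real.norm_natCast, Function.comp_apply]
  gcongr
  exact Nat.le_succ _

theorem ae_exists_pastDepthLT {M : ℝ} (hM : IsLipschitzUnmarked μ M) (τ : T) :
    ∀ᵐ ω ∂(configLaw τ μ), ∃ k, ω ∈ pastDepthLT T k := by
  rw [ae_iff, ← measureReal_eq_zero_iff]
  refine le_antisymm (ge_of_tendsto' (tendsto_pow_div_factorial M) fun k => ?_) measureReal_nonneg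
  refine le_trans (measureReal_mono fun ω hω => ?_) (prob_deep_le hM k τ)
  exact fun h => hω ⟨_, h⟩

theorem bpNonexplosive_of_lipschitz {M : ℝ} (hM : IsLipschitzUnmarked μ M) (τ : T) :
    BPNonexplosive τ μ := by
  filter_upwards [ae_zip (ae_exists_pastDepthLT hM τ)] with p ⟨k, hk⟩
  exact past_finite hk

theorem bpIota_eq {M : ℝ} (hM : IsLipschitzUnmarked μ M) {F : T → ℝ → ℝ}
    (hF : IsFluidLimit μ F) (τ : T) : bpIota τ μ = F τ 1 := by
  set Q := (offspringLaw τ μ).prod (labelLaw (Node T)) with hQ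
  set Z : (Node T → T → ℕ) × (Node T → unitInterval) → Config T := fun p v => (p.1 v, p.2 v)
  have hreal : ∀ A : Set (Config T), MeasurableSet A → Q.real (Z ⁻¹' A) = (configLaw τ μ).real A :=
    fun A hA => by
      rw [← offspringLaw_prod_labelLaw_map, map_measureReal_apply measurable_zip hA]
  set R := {p : (Node T → T → ℕ) × (Node T → unitInterval) |
    RootOccupied (branchingTree p.1) p.2 []}
  have hinj := ae_zip (ae_injective_labels τ μ)
  have hbound : ∀ k : ℕ, |Q.real R - F τ 1| ≤ 2 * (M ^ (k + 1) / ((k + 2).factorial : ℝ)) := by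
    intro k
    have h1 := abs_prob_occupied_sub_le hM hF k τ
    have h2 := prob_deep_le hM k τ
    rw [← hreal _ (measurableSet_occupiedUpTo _)] at h1
    rw [← hreal _ (measurableSet_pastDepthLT _).compl] at h2
    have h3 : Q.real R ≤ Q.real (Z ⁻¹' occupiedUpTo T (k + 1)) +
        Q.real (Z ⁻¹' (pastDepthLT T (k + 1))ᶜ) := by
      refine le_trans ?_ (measureReal_union_le _ _)
      refine ENNReal.toReal_mono (measure_ne_top _ _) (measure_mono_ae ?_)
      filter_upwards [hinj] with p hp hR
      by_cases hd : Z p ∈ pastDepthLT T (k + 1)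
      · exact Or.inl ((rootOccupied_iff hd hp).1 hR)
      · exact Or.inr hd
    have h4 : Q.real (Z ⁻¹' occupiedUpTo T (k + 1)) ≤ Q.real R +
        Q.real (Z ⁻¹' (pastDepthLT T (k + 1))ᶜ) := by
      refine le_trans ?_ (measureReal_union_le _ _)
      refine ENNReal.toReal_mono (measure_ne_top _ _) (measure_mono_ae ?_)
      filter_upwards [hinj] with p hp hO
      by_cases hd : Z p ∈ pastDepthLT T (k + 1)
      · exact Or.inl ((rootOccupied_iff hd hp).2 hO)
      · exact Or.inr hd
    rw [abs_le] at h1 ⊢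
    constructor <;> linarith [h1.1, h1.2]
  have hlim := (tendsto_pow_div_factorial M).const_mul 2
  rw [mul_zero] at hlim
  have h0 : |Q.real R - F τ 1| ≤ 0 := ge_of_tendsto' hlim hbound
  exact sub_eq_zero.1 (abs_nonpos_iff.1 h0)

end Recursion

section GaltonWatson

theorem integral_pow_poissonMeasure (lam : ℝ≥0) (s : ℝ) :
    ∫ m, (1 - s) ^ m ∂(poissonMeasure lam) = Real.exp (-(lam * s)) := by
  rw [integral_poissonMeasure]
  have h := (NormedSpace.expSeries_div_hasSum_exp ((lam : ℝ) * (1 - s))).mul_left (Real.exp (-lam))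
  rw [← Real.exp_eq_exp_ℝ, ← Real.exp_add] at h
  rw [show -((lam : ℝ) * s) = -lam + lam * (1 - s) by ring, ← h.tsum_eq]
  refine tsum_congr fun m => ?_
  rw [mul_pow, smul_eq_mul]
  ring

theorem abs_exp_neg_sub_exp_neg_le {a b : ℝ} (ha : 0 ≤ a) (hb : 0 ≤ b) :
    |Real.exp (-a) - Real.exp (-b)| ≤ |a - b| := by
  wlog hab : a ≤ b generalizing a b
  · rw [abs_sub_comm, abs_sub_comm a]
    exact this hb ha (le_of_not_ge hab)
  rw [abs_of_nonneg (sub_nonneg.2 (Real.exp_le_exp.2 (by linarith))), abs_sub_comm,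
    abs_of_nonneg (by linarith)]
  have h1 : Real.exp (-b) = Real.exp (-a) * Real.exp (-(b - a)) := by
    rw [← Real.exp_add]; congr 1; ring
  have h2 := Real.add_one_le_exp (-(b - a))
  have h3 : Real.exp (-a) ≤ 1 := Real.exp_le_one_iff.2 (by linarith)
  have h4 := Real.exp_pos (-a)
  rw [h1]
  nlinarith

instance (lam : ℝ≥0) (k j : Unit) : IsProbabilityMeasure (gwOffspring lam k j) := by
  unfold gwOffspring; infer_instance

instance (lam : ℝ≥0) (k j : SBType) : IsProbabilityMeasure (sbgwOffspring lam k j) := by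
  cases k <;> cases j <;> unfold sbgwOffspring <;> infer_instance

instance : Fintype SBType :=
  ⟨⟨{.spine, .tree}, by simp⟩, by rintro (_ | _) <;> simp⟩

theorem prod_sbType (f : SBType → ℝ) : ∏ j, f j = f .spine * f .tree := by
  simp [Finset.univ, Fintype.elems]

theorem unmarkedProb_gw (lam : ℝ≥0) (τ : Unit) (s : Unit → ℝ) :
    unmarkedProb (gwOffspring lam) τ s = Real.exp (-(lam * s ())) := by
  simp [unmarkedProb, gwOffspring, integral_pow_poissonMeasure]

theorem unmarkedProb_spine (lam : ℝ≥0) (s : SBType → ℝ) :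
    unmarkedProb (sbgwOffspring lam) .spine s =
      (1 - s .spine) * Real.exp (-(lam * s .tree)) := by
  simp [unmarkedProb, prod_sbType, sbgwOffspring, integral_pow_poissonMeasure]

theorem unmarkedProb_tree (lam : ℝ≥0) (s : SBType → ℝ) :
    unmarkedProb (sbgwOffspring lam) .tree s = Real.exp (-(lam * s .tree)) := by
  simp [unmarkedProb, prod_sbType, sbgwOffspring, integral_pow_poissonMeasure]

theorem abs_exp_neg_mul_sub_le {lam : ℝ≥0} (hlam : lam ≤ 1) {a b δ : ℝ} (ha : 0 ≤ a) (hb : 0 ≤ b)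
    (h : |a - b| ≤ δ) : |Real.exp (-(lam * a)) - Real.exp (-(lam * b))| ≤ δ := by
  refine (abs_exp_neg_sub_exp_neg_le (by positivity) (by positivity)).trans ?_
  rw [← mul_sub, abs_mul, abs_of_nonneg lam.coe_nonneg]
  exact (mul_le_of_le_one_left (abs_nonneg _) (by exact_mod_cast hlam)).trans h

theorem isLipschitzUnmarked_gw {lam : ℝ≥0} (hlam : lam ≤ 1) :
    IsLipschitzUnmarked (gwOffspring lam) 2 := by
  intro τ s s' hs hs' δ hδ
  have h := abs_exp_neg_mul_sub_le hlam (hs ()).1 (hs' ()).1 (hδ ())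
  rw [unmarkedProb_gw, unmarkedProb_gw]
  linarith [(abs_nonneg _).trans h]

theorem isLipschitzUnmarked_sbgw {lam : ℝ≥0} (hlam : lam ≤ 1) :
    IsLipschitzUnmarked (sbgwOffspring lam) 2 := by
  intro τ s s' hs hs' δ hδ
  have h := abs_exp_neg_mul_sub_le hlam (hs .tree).1 (hs' .tree).1 (hδ .tree)
  have hδ0 := (abs_nonneg _).trans h
  cases τ with
  | tree =>
    rw [unmarkedProb_tree, unmarkedProb_tree]
    linarith
  | spine =>
    rw [unmarkedProb_spine, unmarkedProb_spine]
    set x := Real.exp (-(lam * s .tree))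
    set x' := Real.exp (-(lam * s' .tree))
    have hx' : x' ≤ 1 := Real.exp_le_one_iff.2 (by
      have := (hs' .tree).1
      have : 0 ≤ lam * s' .tree := by positivity
      linarith)
    have hx0 : 0 ≤ x' := (Real.exp_pos _).le
    calc |(1 - s .spine) * x - (1 - s' .spine) * x'|
        = |(1 - s .spine) * (x - x') - (s .spine - s' .spine) * x'| := by congr 1; ring
      _ ≤ |(1 - s .spine) * (x - x')| + |(s .spine - s' .spine) * x'| := abs_sub _ _
      _ = (1 - s .spine) * |x - x'| + |s .spine - s' .spine| * x' := by
          rw [abs_mul, abs_mul, abs_of_nonneg hx0, abs_of_nonneg (sub_nonneg.2 (hs .spine).2)]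
      _ ≤ 1 * δ + δ * 1 := by
          have h0 := (hs .spine).1
          have h1 := (hs .spine).2
          gcongr
          · linarith
          · exact hδ _
      _ = 2 * δ := by ring

/-- The probability that the root of the Poisson Galton–Watson tree is occupied and has a label
below `t`. -/
noncomputable def gwLimit (lam t : ℝ) : ℝ := Real.log (1 + lam * t) / lam

variable {lam : ℝ}

theorem exp_neg_mul_gwLimit (hlam : 0 < lam) {t : ℝ} (ht : 0 ≤ t) :
    Real.exp (-(lam * gwLimit lam t)) = (1 + lam * t)⁻¹ := by
  have : 0 < 1 + lam * t := by positivity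
  rw [gwLimit, mul_div_cancel₀ _ hlam.ne', Real.exp_neg, Real.exp_log this]

theorem hasDerivAt_gwLimit (hlam : 0 < lam) {t : ℝ} (ht : 0 ≤ t) :
    HasDerivAt (gwLimit lam) (1 + lam * t)⁻¹ t := by
  have hpos : 0 < 1 + lam * t := by positivity
  have h := ((((hasDerivAt_id t).const_mul lam).const_add 1).log hpos.ne').div_const lam
  refine h.congr_deriv ?_
  rw [mul_one, div_div, mul_comm _ lam, ← div_div, div_self hlam.ne', one_div]
  rfl

theorem gwLimit_mem_Icc (hlam : 0 < lam) {t : ℝ} (ht : 0 ≤ t) :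
    gwLimit lam t ∈ Set.Icc (0 : ℝ) t := by
  have h0 : 0 ≤ lam * t := by positivity
  refine ⟨div_nonneg (Real.log_nonneg (by linarith)) hlam.le, ?_⟩
  rw [gwLimit, div_le_iff₀ hlam]
  linarith [Real.log_le_sub_one_of_pos (show 0 < 1 + lam * t by positivity)]

theorem continuousOn_inv_one_add_mul (hlam : 0 < lam) :
    ContinuousOn (fun t : ℝ => (1 + lam * t)⁻¹) (Set.Icc 0 1) := by
  refine ContinuousOn.inv₀ (by fun_prop) fun t ht => ?_
  have := ht.1
  positivity

theorem integral_inv_one_add_mul (hlam : 0 < lam) {t : ℝ} (ht : t ∈ Set.Icc (0 : ℝ) 1) :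
    ∫ s in (0 : ℝ)..t, (1 + lam * s)⁻¹ = gwLimit lam t := by
  rw [intervalIntegral.integral_eq_sub_of_hasDerivAt (f := gwLimit lam)]
  · simp [gwLimit]
  · intro s hs
    rw [Set.uIcc_of_le ht.1] at hs
    exact hasDerivAt_gwLimit hlam hs.1
  · refine ((continuousOn_inv_one_add_mul hlam).mono ?_).intervalIntegrable
    rw [Set.uIcc_of_le ht.1]
    exact Set.Icc_subset_Icc_right ht.2

theorem integral_exp_neg_gwLimit (hlam : 0 < lam) {t : ℝ} (ht : t ∈ Set.Icc (0 : ℝ) 1) :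
    ∫ s in (0 : ℝ)..t, Real.exp (-gwLimit lam s) * (1 + lam * s)⁻¹ =
      1 - Real.exp (-gwLimit lam t) := by
  have hcont : ContinuousOn (gwLimit lam) (Set.uIcc 0 t) := fun s hs => by
    rw [Set.uIcc_of_le ht.1] at hs
    exact (hasDerivAt_gwLimit hlam hs.1).continuousAt.continuousWithinAt
  rw [intervalIntegral.integral_eq_sub_of_hasDerivAt (f := fun s => -Real.exp (-gwLimit lam s))]
  · simp [gwLimit]; ring
  · intro s hs
    rw [Set.uIcc_of_le ht.1] at hs
    have h := ((hasDerivAt_gwLimit hlam hs.1).neg.exp).neg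
    rw [mul_neg, neg_neg] at h
    exact h
  · refine (ContinuousOn.mul (by fun_prop) ((continuousOn_inv_one_add_mul hlam).mono
      ?_)).intervalIntegrable
    rw [Set.uIcc_of_le ht.1]
    exact Set.Icc_subset_Icc_right ht.2

theorem isFluidLimit_gw {lam : ℝ≥0} (hlam : 0 < lam) :
    IsFluidLimit (gwOffspring lam) fun _ => gwLimit lam where
  continuousOn τ := by
    refine (continuousOn_inv_one_add_mul (lam := lam) (by exact_mod_cast hlam)).congr fun t ht => ?_
    simp only [unmarkedProb_gw]
    exact exp_neg_mul_gwLimit (by exact_mod_cast hlam) ht.1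
  mem_Icc τ t ht := gwLimit_mem_Icc (by exact_mod_cast hlam) ht.1
  eq_integral τ t ht := by
    rw [← integral_inv_one_add_mul (by exact_mod_cast hlam) ht]
    refine intervalIntegral.integral_congr fun s hs => ?_
    rw [Set.uIcc_of_le ht.1] at hs
    simp only [unmarkedProb_gw]
    exact (exp_neg_mul_gwLimit (by exact_mod_cast hlam) hs.1).symm

/-- The probability that the root is occupied and has a label below `t`, in the size-biased Poisson
Galton–Watson tree started from a vertex of the given type. -/
noncomputable def sbgwLimit (lam : ℝ) : SBType → ℝ → ℝ
  | .spine, t => 1 - Real.exp (-gwLimit lam t)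
  | .tree, t => gwLimit lam t

theorem isFluidLimit_sbgw {lam : ℝ≥0} (hlam : 0 < lam) :
    IsFluidLimit (sbgwOffspring lam) (sbgwLimit lam) where
  continuousOn τ := by
    have hlam' : (0 : ℝ) < lam := by exact_mod_cast hlam
    have hcont : ContinuousOn (gwLimit lam) (Set.Icc 0 1) := fun s hs =>
      (hasDerivAt_gwLimit hlam' hs.1).continuousAt.continuousWithinAt
    cases τ with
    | tree =>
      refine (continuousOn_inv_one_add_mul hlam').congr fun t ht => ?_
      simp only [unmarkedProb_tree]
      exact exp_neg_mul_gwLimit hlam' ht.1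
    | spine =>
      simp only [unmarkedProb_spine, sbgwLimit]
      fun_prop
  mem_Icc τ t ht := by
    have hlam' : (0 : ℝ) < lam := by exact_mod_cast hlam
    have h := gwLimit_mem_Icc hlam' ht.1
    cases τ with
    | tree => exact h
    | spine =>
      simp only [sbgwLimit]
      refine ⟨sub_nonneg.2 (Real.exp_le_one_iff.2 (by linarith [h.1])), ?_⟩
      linarith [Real.add_one_le_exp (-gwLimit lam t), h.2]
  eq_integral τ t ht := by
    have hlam' : (0 : ℝ) < lam := by exact_mod_cast hlam
    cases τ with
    | tree =>
      rw [sbgwLimit, ← integral_inv_one_add_mul hlam' ht]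
      refine intervalIntegral.integral_congr fun s hs => ?_
      rw [Set.uIcc_of_le ht.1] at hs
      simp only [unmarkedProb_tree]
      exact (exp_neg_mul_gwLimit hlam' hs.1).symm
    | spine =>
      rw [sbgwLimit, ← integral_exp_neg_gwLimit hlam' ht]
      refine intervalIntegral.integral_congr fun s hs => ?_
      rw [Set.uIcc_of_le ht.1] at hs
      simp only [unmarkedProb_spine, sbgwLimit]
      rw [exp_neg_mul_gwLimit hlam' hs.1, sub_sub_cancel]

theorem bpIota_gw {lam : ℝ≥0} (hlam : 0 < lam) (hlam' : lam ≤ 1) :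
    bpIota () (gwOffspring lam) = gwLimit lam 1 :=
  bpIota_eq (isLipschitzUnmarked_gw hlam') (isFluidLimit_gw hlam) ()

theorem bpIota_sbgw {lam : ℝ≥0} (hlam : 0 < lam) (hlam' : lam ≤ 1) :
    bpIota .spine (sbgwOffspring lam) = 1 - Real.exp (-gwLimit lam 1) :=
  bpIota_eq (isLipschitzUnmarked_sbgw hlam') (isFluidLimit_sbgw hlam) .spine

theorem bpIota_sbgw_eq_rpow {lam : ℝ≥0} (hlam : 0 < lam) (hlam' : lam ≤ 1) :
    bpIota .spine (sbgwOffspring lam) = 1 - (1 + (lam : ℝ)) ^ (-1 / (lam : ℝ)) := by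
  rw [bpIota_sbgw hlam hlam', Real.rpow_def_of_pos (by positivity), gwLimit, mul_one]
  congr 2
  ring

theorem bpIota_sbgw_one : bpIota .spine (sbgwOffspring 1) = 1 / 2 := by
  rw [bpIota_sbgw_eq_rpow one_pos le_rfl]
  norm_num [Real.rpow_neg_one]

end GaltonWatson

end GreedyMIS

theorem mainTheorem6 :
    (∀ lam : ℝ≥0, 0 < lam → lam ≤ 1 →
      GreedyMIS.BPNonexplosive GreedyMIS.SBType.spine (GreedyMIS.sbgwOffspring lam) ∧
      GreedyMIS.BPNonexplosive () (GreedyMIS.gwOffspring lam) ∧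
      GreedyMIS.bpIota GreedyMIS.SBType.spine (GreedyMIS.sbgwOffspring lam)
        = 1 - (1 + (lam : ℝ)) ^ (-1 / (lam : ℝ)) ∧
      GreedyMIS.bpIota GreedyMIS.SBType.spine (GreedyMIS.sbgwOffspring lam)
        = 1 - Real.exp (-GreedyMIS.bpIota () (GreedyMIS.gwOffspring lam))) ∧
    GreedyMIS.bpIota GreedyMIS.SBType.spine (GreedyMIS.sbgwOffspring 1) = 1 / 2 ∧
    GreedyMIS.AsympWhp
      (fun n => GreedyMIS.greedyRatioLaw (GreedyMIS.uniformTree (n + 1))) (1 / 2) ∧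
    GreedyMIS.AsympWhp
      (fun n => GreedyMIS.greedyRatioLaw (GreedyMIS.randomFunctionalGraph (n + 1))) (1 / 2) := by
  refine ⟨fun lam h0 h1 => ⟨?_, ?_, ?_, ?_⟩, ?_, ?_, ?_⟩
  · exact GreedyMIS.bpNonexplosive_of_lipschitz (GreedyMIS.isLipschitzUnmarked_sbgw h1) _
  · exact GreedyMIS.bpNonexplosive_of_lipschitz (GreedyMIS.isLipschitzUnmarked_gw h1) _
  · exact GreedyMIS.bpIota_sbgw_eq_rpow h0 h1
  · rw [GreedyMIS.bpIota_gw h0 h1, GreedyMIS.bpIota_sbgw h0 h1]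
  · exact GreedyMIS.bpIota_sbgw_one
  · exact GreedyMIS.asympWhp_uniformTree
  · exact GreedyMIS.asympWhp_randomFunctionalGraph
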